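/- Let $X=\{0,1\}^{\mathbb N}$ be the group of sequences $x=(x_1,x_2,\dots)$ under addition modulo $2$, with the $\sigma$-algebra generated by the sets $\{x:x_k=1\}$; let $\delta_k$ be the sequence whose only nonzero entry is the $k$-th, $\Delta\subset X$ the subgroup generated by the $\delta_k$, and $1-x=(1-x_1,1-x_2,\dots)$. Let $Z$ be an infinite-dimensional separable real (pre-)Hilbert space with a compatible complex structure $\sigma$ and a unitary basis $z_1,z_2,\dots$ of $(Z,\sigma)$, i.e. $\{z_k,\sigma z_k\}$ is a real orthonormal basis, and let $C(Z)$ be its Clifford algebra, with relations $zw+wz=-2(z,w)$. A *GW triple* $(\mu,\nu,\{c_k\})$ consists of a $\sigma$-finite measure $\mu$ on $X$ whose translates by elements of $\Delta$ are all equivalent to $\mu$; a measurable $\nu:X\to\{1,2,\dots,\infty\}$ with $\nu(x+\delta)=\nu(x)$ for each $\delta\in\Delta$ and almost all $x$; and unitary operators $c_k(x)$ of $H_x$, measurable in $x$, such that for almost all $x$ $$c_k(x)^*=c_k(x+\delta_k),\qquad c_k(x)c_l(x+\delta_k)=c_l(x)c_k(x+\delta_l).$$ Here $H_x=\mathbb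 C\otimes K_x$, where $K_x$ is the standard real Hilbert space of dimension $\nu(x)$ (sequences in $\ell^2(\mathbb N,\mathbb R)$ supported in the first $\nu(x)$ places), so that $H_{x+\delta}=H_x$ almost everywhere; $\bar{\ }$ denotes the conjugation of $H_x$ with respect to $K_x$, and $\overline{A}\,v=\overline{A\bar v}$ for an operator $A$. On $H=\int_X^\oplus H_x\,d\mu(x)$ the formulas $$(J_{z_k}f)(x)=(-1)^{x_1+\dots+x_{k-1}+1}\,i\,c_k(x)\sqrt{\tfrac{d\mu(x+\delta_k)}{d\mu(x)}}\,f(x+\delta_k),\qquad (J_{\sigma z_k}f)(x)=(-1)^{x_k}\,i\,(J_{z_k}f)(x)$$ determine a unique representation of $C(Z)$ that is continuous on $Z$; $H$ with this representation is the *GW module* of the triple. An *invariant real form* of $H$ is a $C(Z)$-invariant real subspace $V$ with $H=V\oplus iV$ on which the inner product of $H$ is real-valued. Put $\tilde\mu(E)=\mu(1-E)$. **Theorem.** (1) The formulas above define one and only one such representation for every GW triple. If moreover $\tilde\mu$ and $\mu$ are equivalent and, for almost all $x$ and all $k\ge1$, $$\nu(1-x)=\nu(x),\qquad \overline{c_k(1-x)}=(-1)^k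 c_k(x),$$ then $$H^{\mathbb R}=\Big\{f\in H:\ \overline{f(x)}=\sqrt{\tfrac{d\mu(1-x)}{d\mu(x)}}\,f(1-x)\ \text{for almost all }x\Big\},\qquad \tfrac{d\mu(1-x)}{d\mu(x)}:=\tfrac{d\tilde\mu}{d\mu}(x),$$ is an invariant real form of $H$. (2) Conversely, for every GW module $H$ and every invariant real form $V$ of $H$ there are a GW triple satisfying the conditions of (1), with module $H'$ and real form $H'^{\,\mathbb R}$, and a unitary isomorphism $U:H\to H'$ that intertwines the representations of $C(Z)$ and satisfies $U(V)=H'^{\,\mathbb R}$. -/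

import Mathlib

open MeasureTheory

noncomputable section

namespace GW

/-! ### Sequences of occupation numbers -/

/-- The group of sequences of `0`s and `1`s under componentwise addition modulo `2`, with the
σ-algebra generated by the sets `{x | x k = 1}`.  Coordinates are indexed from `0`: the index
`k : ℕ` here is the `(k + 1)`-st coordinate. -/
abbrev X : Type := ℕ → ZMod 2

/-- The subgroup of sequences with only finitely many `1`s. -/
def Delta : AddSubgroup X where
  carrier := {x | {k | x k ≠ 0}.Finite}
  zero_mem' := by simp
  add_mem' := by
    intro a b ha hb
    refine (Set.Finite.union ha hb).subset ?_
    intro k hk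
    by_cases h : a k = 0
    · exact Or.inr fun h' => hk (by simp [h, h'])
    · exact Or.inl h
  neg_mem' := by
    intro a ha
    simpa using ha

/-- The sequence whose only nonzero component is the `k`-th. -/
def delta (k : ℕ) : X := Pi.single k 1

/-! ### The fibres -/

/-- The space `ℓ²(ℕ, ℂ)`, in which the fibres are realized.  Complex conjugation with respect to
the real form `ℓ²(ℕ, ℝ)` is `star`, taken in each coordinate. -/
abbrev E : Type := lp (fun _ : ℕ => ℂ) 2

/-- The standard Hilbert space of dimension `n ∈ {0, 1, …, ∞}`: the sequences supported in
`{0, …, n - 1}`.  It is the complexification of the real sequences it contains. -/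
def fiber (n : ℕ∞) : Submodule ℂ E where
  carrier := {v | ∀ i : ℕ, n ≤ (i : ℕ∞) → v i = 0}
  zero_mem' := by intro i _; simp
  add_mem' := by
    intro a b ha hb i hi
    simp [ha i hi, hb i hi]
  smul_mem' := by
    intro c a ha i hi
    simp [ha i hi]

/-- `A` is a unitary operator of the subspace `F` (extended by zero to the orthogonal complement
of `F`, so that operators on different fibres can be composed and compared). -/
structure IsUnitaryOn (F : Submodule ℂ E) (A : E →L[ℂ] E) : Prop where
  norm_map : ∀ v ∈ F, ‖A v‖ = ‖v‖
  map_eq : F.map (A : E →ₗ[ℂ] E) = F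
  map_orthogonal : ∀ v ∈ Fᗮ, A v = 0

/-! ### The triples -/

/-- A triple `(μ, ν, {c_k})`.  The fibre over `x` is `H_x = fiber (ν x)`, so that
`H_{x + δ} = H_x` for almost all `x`. -/
structure Triple where
  /-- the measure -/
  μ : Measure X
  sigmaFinite : SigmaFinite μ
  /-- `μ` is quasi-invariant: all its translates by elements of `Delta` are equivalent to it -/
  quasiInvariant : ∀ δ ∈ Delta, μ.map (fun x => x + δ) ≪ μ ∧ μ ≪ μ.map (fun x => x + δ)
  /-- the dimension function -/
  ν : X → ℕ∞
  measurable_ν : Measurable ν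
  one_le_ν : ∀ x, 1 ≤ ν x
  ν_add : ∀ δ ∈ Delta, ∀ᵐ x ∂μ, ν (x + δ) = ν x
  /-- the unitary operators -/
  c : ℕ → X → (E →L[ℂ] E)
  measurable_c : ∀ k v, AEStronglyMeasurable (fun x => c k x v) μ
  unitary_c : ∀ k, ∀ᵐ x ∂μ, IsUnitaryOn (fiber (ν x)) (c k x)
  adjoint_c : ∀ k, ∀ᵐ x ∂μ, ContinuousLinearMap.adjoint (c k x) = c k (x + delta k)
  comm_c : ∀ k l, ∀ᵐ x ∂μ, c k x ∘L c l (x + delta k) = c l x ∘L c k (x + delta l)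

namespace Triple

variable (D : Triple)

/-- The direct integral `∫^⊕ H_x dμ(x)`: the square-integrable `f` with `f x ∈ H_x` for almost
all `x`. -/
def space : Submodule ℂ (Lp E 2 D.μ) where
  carrier := {f | ∀ᵐ x ∂D.μ, f x ∈ fiber (D.ν x)}
  zero_mem' := by
    filter_upwards [Lp.coeFn_zero E 2 D.μ] with x hx
    rw [hx]
    exact Submodule.zero_mem _
  add_mem' := by
    intro f g hf hg
    filter_upwards [hf, hg, Lp.coeFn_add f g] with x h1 h2 h
    rw [h]
    exact Submodule.add_mem _ h1 h2
  smul_mem' := by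
    intro a f hf
    filter_upwards [hf, Lp.coeFn_smul a f] with x h1 h
    rw [h]
    exact Submodule.smul_mem _ a h1

/-- The derivative `dμ(x + δ_k) / dμ(x)`. -/
def shiftDensity (k : ℕ) (x : X) : ℝ :=
  ((D.μ.map (fun y => y + delta k)).rnDeriv D.μ x).toReal

/-- The measure `E ↦ μ(1 - E)`. -/
def reflected : Measure X := D.μ.map (fun x => 1 - x)

/-- The derivative `dμ(1 - x) / dμ(x)`. -/
def reflDensity (x : X) : ℝ := (D.reflected.rnDeriv D.μ x).toReal

end Triple

/-! ### The Clifford algebra -/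

/-- The quadratic form `z ↦ -(z, z)`; its Clifford algebra is the quotient of the tensor algebra
of `Z` by the relations `z₁ z₂ + z₂ z₁ + 2 (z₁, z₂) = 0`. -/
def negForm (Z : Type*) [NormedAddCommGroup Z] [InnerProductSpace ℝ Z] : QuadraticForm ℝ Z :=
  -(LinearMap.BilinMap.toQuadraticMap (innerₗ Z))

/-- A complex structure `σ` on `Z` compatible with the metric, and a unitary basis `z_0, z_1, …`
of `(Z, σ)`: the vectors `z_k`, `σ z_k` form a real orthonormal basis of `Z`. -/
structure Frame (Z : Type*) [NormedAddCommGroup Z] [InnerProductSpace ℝ Z] where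
  σ : Z ≃ₗᵢ[ℝ] Z
  σ_σ : ∀ v, σ (σ v) = -v
  z : ℕ → Z
  orthonormal : Orthonormal ℝ (Sum.elim z (fun k => σ (z k)))
  dense : (Submodule.span ℝ (Set.range (Sum.elim z (fun k => σ (z k))))).topologicalClosure = ⊤

section Representations

variable {Z : Type*} [NormedAddCommGroup Z] [InnerProductSpace ℝ Z]

/-- `ρ` is the representation of the Clifford algebra of `Z` on the direct integral that belongs
to the triple `D`: it is continuous on `Z`, and on the basis it is given by
`(J_{z_k} f)(x) = (-1)^{x_1 + ⋯ + x_{k-1} + 1} i c_k(x) √(dμ(x + δ_k)/dμ(x)) f(x + δ_k)` and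
`(J_{σ z_k} f)(x) = (-1)^{x_k} i (J_{z_k} f)(x)`. -/
structure Triple.IsRep (D : Triple) (b : Frame Z)
    (ρ : CliffordAlgebra (negForm Z) →ₐ[ℝ] (D.space →L[ℂ] D.space)) : Prop where
  continuous : Continuous fun v : Z => ρ (CliffordAlgebra.ι (negForm Z) v)
  apply_z : ∀ (k : ℕ) (f : D.space), ∀ᵐ x ∂D.μ,
    (ρ (CliffordAlgebra.ι (negForm Z) (b.z k)) f : Lp E 2 D.μ) x =
      ((-1 : ℂ) ^ ((∑ j ∈ Finset.range k, (x j).val) + 1) * Complex.I) •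
        D.c k x (((√(D.shiftDensity k x) : ℝ) : ℂ) • (f : Lp E 2 D.μ) (x + delta k))
  apply_σz : ∀ (k : ℕ) (f : D.space), ∀ᵐ x ∂D.μ,
    (ρ (CliffordAlgebra.ι (negForm Z) (b.σ (b.z k))) f : Lp E 2 D.μ) x =
      ((-1 : ℂ) ^ (x k).val * Complex.I) •
        (ρ (CliffordAlgebra.ι (negForm Z) (b.z k)) f : Lp E 2 D.μ) x

/-- `V` is an invariant real form of the complex module `H`: it is a real subspace, invariant
under the Clifford algebra, with `H = V ⊕ iV`, and the inner product of `H` is real on `V`, so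
that `H` is the complexification of the real inner product space `V`. -/
structure IsInvariantRealForm {H : Type*} [NormedAddCommGroup H] [InnerProductSpace ℂ H]
    (ρ : CliffordAlgebra (negForm Z) →ₐ[ℝ] (H →L[ℂ] H)) (V : Submodule ℝ H) : Prop where
  invariant : ∀ a, ∀ f ∈ V, ρ a f ∈ V
  existsUnique_add : ∀ h : H, ∃! p : V × V, h = (p.1 : H) + Complex.I • (p.2 : H)
  inner_real : ∀ f ∈ V, ∀ g ∈ V, (inner ℂ f g).im = 0

end Representations

/-! ### The standard type -/

namespace Triple

variable (D : Triple)

/-- The triples of standard type: the measure `μ(1 - ·)` is equivalent to `μ`,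
`ν(1 - x) = ν(x)`, and the conjugate of `c_k(1 - x)` is `(-1)^k c_k(x)`, where the conjugate of
an operator `A` is `v ↦ conj (A (conj v))`.  With indices from `0` the sign is
`(-1)^(k + 1)`. -/
structure IsStandard : Prop where
  reflected_ac : D.reflected ≪ D.μ
  ac_reflected : D.μ ≪ D.reflected
  ν_refl : ∀ᵐ x ∂D.μ, D.ν (1 - x) = D.ν x
  c_refl : ∀ k, ∀ᵐ x ∂D.μ, ∀ v : E, star (D.c k (1 - x) (star v)) = (-1 : ℂ) ^ (k + 1) • D.c k x v

variable {D}

theorem IsStandard.quasi (h : D.IsStandard) :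
    Measure.QuasiMeasurePreserving (fun x : X => 1 - x) D.μ D.μ :=
  ⟨measurable_pi_lambda _ fun k => (measurable_of_countable fun t : ZMod 2 => 1 - t).comp
    (measurable_pi_apply k), h.reflected_ac⟩

/-- The real subspace of all `f` with `conj (f x) = √(dμ(1 - x)/dμ(x)) f(1 - x)` for almost
all `x`. -/
def IsStandard.realForm (h : D.IsStandard) : Submodule ℝ D.space where
  carrier := {f | ∀ᵐ x ∂D.μ, star ((f : Lp E 2 D.μ) x) =
    ((√(D.reflDensity x) : ℝ) : ℂ) • (f : Lp E 2 D.μ) (1 - x)}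
  zero_mem' := by
    have h0 := Lp.coeFn_zero E 2 D.μ
    filter_upwards [h0, h.quasi.ae h0] with x h1 h2
    simp only [Submodule.coe_zero, h1, h2, Pi.zero_apply, star_zero, smul_zero]
  add_mem' := by
    intro f g hf hg
    have h0 := Lp.coeFn_add (f : Lp E 2 D.μ) (g : Lp E 2 D.μ)
    change ∀ᵐ x ∂D.μ, star (((f + g : D.space) : Lp E 2 D.μ) x) =
      ((√(D.reflDensity x) : ℝ) : ℂ) • ((f + g : D.space) : Lp E 2 D.μ) (1 - x)
    filter_upwards [h0, h.quasi.ae h0, hf, hg] with x h1 h2 h3 h4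
    simp only [Submodule.coe_add, h1, h2, Pi.add_apply, star_add, smul_add, h3, h4]
  smul_mem' := by
    intro a f hf
    have h0 := Lp.coeFn_smul (a : ℂ) (f : Lp E 2 D.μ)
    change ∀ᵐ x ∂D.μ, star (((a • f : D.space) : Lp E 2 D.μ) x) =
      ((√(D.reflDensity x) : ℝ) : ℂ) • ((a • f : D.space) : Lp E 2 D.μ) (1 - x)
    filter_upwards [h0, h.quasi.ae h0, hf] with x h1 h2 h3
    change star (((a : ℂ) • (f : Lp E 2 D.μ) : Lp E 2 D.μ) x) =
      _ • ((a : ℂ) • (f : Lp E 2 D.μ) : Lp E 2 D.μ) (1 - x)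
    rw [h1, h2, Pi.smul_apply, Pi.smul_apply, star_smul, h3, smul_comm]
    simp

end Triple

end GW

end

noncomputable section

namespace GW

open scoped ENNReal

/-! Part (1), existence and uniqueness. Each basis vector acts as a scalar of modulus one times a
unitary of the fibre times a weighted composition with an involution of `X`. The weights satisfy the
chain rule of Radon–Nikodym derivatives, so these operators are isometries and the weights cancel in
squares and match in commutators. The conditions on `c` do the same for the fibre operators. What is
left are signs of Jordan–Wigner type (`coef_mul_self`, `coef_anticomm`), so the operators square to
`-1` and anticommute. Such a family extends linearly to the span of the basis, then by density to
`Z`, and lifts to the Clifford algebra (`exists_rep`); density also gives uniqueness (`rep_ext`).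

Part (1), the real form. The map `f ↦ √(dμ(1 - x)/dμ(x)) conj (f (1 - x))` is an antiunitary
involution whose fixed space is the displayed subspace. The sign in `c_refl` is the one that
compensates the behaviour of the scalar factors under conjugation and reflection (`star_coef`), so
the fixed space is invariant.

Part (2). An invariant real form is the fixed space of an antiunitary involution `C` commuting with
the representation (`exists_conj_of_realForm`). The product of the operators of `σ z_k` and `z_k` is
multiplication by `-i (-1)^{x_k}`. As `C` is antilinear, it anticommutes with multiplication by
`(-1)^{x_k}` (`sgn_conj`), so it lies over the reflection `x ↦ 1 - x`. A π-system argument turns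
this into an identity of measures (`map_withDensity_conj`), which gives the equivalence of `μ` with
its reflection and pointwise preservation of norms. Hence `C` is the standard conjugation composed
with a measurable field of isometries `A x` (`exists_isometry_field`), and `C² = 1` says that `conj
(A (1 - x)) A x = 1`. The reflection has the fundamental domain `{x | x 0 = 0}`; the field `W` equal
to `1` there and to `A` elsewhere carries `C` to the standard conjugation (`exists_unitary_field`).
Twisting the operators `c` by `W` gives an equivalent triple, and commutation with the standard
conjugation forces it to be of standard type (`isStandard_of_conj`). -/

/-! ### Weighted composition with an involution -/

section Weight

variable {α : Type*} [MeasurableSpace α] {μ : Measure α}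

/-- The square root of the density of `μ.map φ` with respect to `μ`. -/
def wt (μ : Measure α) (φ : α → α) (x : α) : ℝ := √((μ.map φ).rnDeriv μ x).toReal

theorem wt_nonneg (φ : α → α) (x : α) : 0 ≤ wt μ φ x := Real.sqrt_nonneg _

theorem measurable_wt (φ : α → α) : Measurable (wt μ φ) :=
  (Measure.measurable_rnDeriv _ _).ennreal_toReal.sqrt

variable [SigmaFinite μ] {φ ψ : α → α}

theorem sigmaFinite_map_involutive (hm : Measurable φ) (hi : Function.Involutive φ) :
    SigmaFinite (μ.map φ) := by
  let e : α ≃ᵐ α := ⟨hi.toPerm, hm, hm⟩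
  exact e.sigmaFinite_map

theorem withDensity_rnDeriv_map (hq : Measure.QuasiMeasurePreserving φ μ μ)
    (hi : Function.Involutive φ) : μ.withDensity ((μ.map φ).rnDeriv μ) = μ.map φ := by
  have := sigmaFinite_map_involutive (μ := μ) hq.measurable hi
  exact Measure.withDensity_rnDeriv_eq _ _ hq.absolutelyContinuous

theorem ofReal_wt_sq (hq : Measure.QuasiMeasurePreserving φ μ μ) (hi : Function.Involutive φ) :
    ∀ᵐ x ∂μ, ENNReal.ofReal (wt μ φ x ^ 2) = (μ.map φ).rnDeriv μ x := by
  have := sigmaFinite_map_involutive (μ := μ) hq.measurable hi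
  filter_upwards [Measure.rnDeriv_lt_top (μ.map φ) μ] with x hx
  rw [wt, Real.sq_sqrt ENNReal.toReal_nonneg, ENNReal.ofReal_toReal hx.ne]

/-- Change of variables, with `φ` its own inverse. Both the chain rule for the weights and the
isometry property of weighted composition come from this identity. -/
theorem map_withDensity_involutive (hq : Measure.QuasiMeasurePreserving φ μ μ)
    (hi : Function.Involutive φ) {g : α → ℝ≥0∞} (hg : Measurable g) :
    (μ.withDensity g).map φ =
      μ.withDensity (fun x => (μ.map φ).rnDeriv μ x * g (φ x)) := by
  have hm := hq.measurable
  have h1 : (μ.withDensity g).map φ = (μ.map φ).withDensity (g ∘ φ) := by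
    ext s hs
    rw [Measure.map_apply hm hs, withDensity_apply _ (hm hs), withDensity_apply _ hs,
      setLIntegral_map hs (hg.comp hm) hm]
    simp [hi _]
  rw [h1]
  conv_lhs => rw [← withDensity_rnDeriv_map hq hi]
  rw [← withDensity_mul _ (Measure.measurable_rnDeriv _ _) (hg.comp hm)]
  rfl

theorem lintegral_rnDeriv_map_mul (hq : Measure.QuasiMeasurePreserving φ μ μ)
    (hi : Function.Involutive φ) {g : α → ℝ≥0∞} (hg : Measurable g) :
    ∫⁻ x, (μ.map φ).rnDeriv μ x * g (φ x) ∂μ = ∫⁻ x, g x ∂μ := by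
  have h := congrArg (fun m => m Set.univ) (map_withDensity_involutive hq hi hg)
  simpa [Measure.map_apply hq.measurable MeasurableSet.univ] using h.symm

theorem rnDeriv_map_comp (hq : Measure.QuasiMeasurePreserving φ μ μ)
    (hi : Function.Involutive φ) (hq' : Measure.QuasiMeasurePreserving ψ μ μ)
    (hi' : Function.Involutive ψ) :
    (μ.map (φ ∘ ψ)).rnDeriv μ =ᵐ[μ]
      fun x => (μ.map φ).rnDeriv μ x * (μ.map ψ).rnDeriv μ (φ x) := by
  have h : μ.map (φ ∘ ψ) = μ.withDensity
      (fun x => (μ.map φ).rnDeriv μ x * (μ.map ψ).rnDeriv μ (φ x)) := by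
    rw [← map_withDensity_involutive hq hi (Measure.measurable_rnDeriv _ _),
      withDensity_rnDeriv_map hq' hi', Measure.map_map hq.measurable hq'.measurable]
  rw [h]
  exact Measure.rnDeriv_withDensity _ ((Measure.measurable_rnDeriv _ _).mul
    ((Measure.measurable_rnDeriv _ _).comp hq.measurable))

theorem wt_comp (hq : Measure.QuasiMeasurePreserving φ μ μ)
    (hi : Function.Involutive φ) (hq' : Measure.QuasiMeasurePreserving ψ μ μ)
    (hi' : Function.Involutive ψ) :
    ∀ᵐ x ∂μ, wt μ φ x * wt μ ψ (φ x) = wt μ (φ ∘ ψ) x := by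
  filter_upwards [rnDeriv_map_comp hq hi hq' hi'] with x hx
  rw [wt, wt, wt, hx, ENNReal.toReal_mul, Real.sqrt_mul ENNReal.toReal_nonneg]

theorem wt_mul_comm (hq : Measure.QuasiMeasurePreserving φ μ μ)
    (hi : Function.Involutive φ) (hq' : Measure.QuasiMeasurePreserving ψ μ μ)
    (hi' : Function.Involutive ψ) (hc : φ ∘ ψ = ψ ∘ φ) :
    ∀ᵐ x ∂μ, wt μ φ x * wt μ ψ (φ x) = wt μ ψ x * wt μ φ (ψ x) := by
  filter_upwards [wt_comp hq hi hq' hi', wt_comp hq' hi' hq hi] with x h1 h2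
  rw [h1, h2, hc]

theorem wt_id : ∀ᵐ x ∂μ, wt μ id x = 1 := by
  filter_upwards [Measure.rnDeriv_self μ] with x hx
  simp [wt, hx]

/-- The chain rule for `φ ∘ φ = id`. -/
theorem wt_mul_self (hq : Measure.QuasiMeasurePreserving φ μ μ)
    (hi : Function.Involutive φ) : ∀ᵐ x ∂μ, wt μ φ x * wt μ φ (φ x) = 1 := by
  filter_upwards [wt_comp hq hi hq hi, wt_id (μ := μ)] with x h1 h2
  rw [h1, hi.comp_self, h2]

theorem wt_pos (hq : Measure.QuasiMeasurePreserving φ μ μ)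
    (hi : Function.Involutive φ) : ∀ᵐ x ∂μ, 0 < wt μ φ x := by
  filter_upwards [wt_mul_self hq hi] with x h1
  refine lt_of_le_of_ne (wt_nonneg _ _) fun h => ?_
  rw [← h, zero_mul] at h1
  exact zero_ne_one h1

/-- Only pointwise norms enter, so this serves linear and antilinear operators alike. -/
theorem eLpNorm_wt_mul (hq : Measure.QuasiMeasurePreserving φ μ μ)
    (hi : Function.Involutive φ) {F : Type*} [NormedAddCommGroup F]
    {f g : α → F} (hf : AEStronglyMeasurable f μ)
    (hg : ∀ᵐ x ∂μ, ‖g x‖ = wt μ φ x * ‖f (φ x)‖) : eLpNorm g 2 μ = eLpNorm f 2 μ := by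
  rw [eLpNorm_eq_lintegral_rpow_enorm_toReal (by simp) (by simp),
    eLpNorm_eq_lintegral_rpow_enorm_toReal (by simp) (by simp)]
  congr 1
  obtain ⟨f', hf', hff⟩ := hf
  rw [lintegral_congr_ae (f := fun x => ‖f x‖ₑ ^ (2 : ℝ≥0∞).toReal)
      (g := fun x => ‖f' x‖ₑ ^ (2 : ℝ≥0∞).toReal)
    (by filter_upwards [hff] with x hx; rw [hx]),
    ← lintegral_rnDeriv_map_mul hq hi (hf'.enorm.pow_const _)]
  refine lintegral_congr_ae ?_
  filter_upwards [hg, ofReal_wt_sq hq hi, hq.ae hff] with x h1 h2 h3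
  rw [← h3, ← h2, ← ofReal_norm, ← ofReal_norm, h1, ENNReal.toReal_ofNat, ENNReal.rpow_ofNat,
    ENNReal.rpow_ofNat, ENNReal.ofReal_mul (wt_nonneg _ _), mul_pow,
    ENNReal.ofReal_pow (wt_nonneg _ _)]

end Weight

/-! ### Coordinates in the fibres -/

/-- The standard basis vectors. -/
def e (i : ℕ) : E := lp.single 2 i (1 : ℂ)

theorem e_apply (i j : ℕ) : (e i : ℕ → ℂ) j = if j = i then 1 else 0 := by
  simp [e, lp.single_apply, Pi.single_apply]

theorem inner_e (i : ℕ) (v : E) : inner ℂ (e i) v = v i := by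
  simp [e, lp.inner_single_left]

theorem orthonormal_e : Orthonormal ℂ e := by
  rw [orthonormal_iff_ite]
  intro i j
  rw [inner_e, e_apply]

theorem hasSum_e (v : E) : HasSum (fun i => v i • e i) v := by
  have h := lp.hasSum_single (p := 2) (by simp) v
  convert h using 2 with i
  rw [e, ← lp.single_smul, smul_eq_mul, mul_one]

theorem star_e (i : ℕ) : star (e i) = e i := by
  ext j
  rw [lp.star_apply, e_apply]
  split_ifs <;> simp

theorem ext_e {A B : E →L[ℂ] E} (h : ∀ i, A (e i) = B (e i)) : A = B := by
  ext1 v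
  have hA := (hasSum_e v).mapL A
  have hB := (hasSum_e v).mapL B
  simp only [map_smul, h] at hA hB
  exact hA.unique hB

theorem mem_fiber {n : ℕ∞} {v : E} : v ∈ fiber n ↔ ∀ i : ℕ, n ≤ (i : ℕ∞) → v i = 0 := Iff.rfl

theorem e_mem_fiber {n : ℕ∞} {i : ℕ} (h : (i : ℕ∞) < n) : e i ∈ fiber n := by
  intro j hj
  rw [e_apply, if_neg]
  rintro rfl
  exact absurd h (not_lt.2 hj)

theorem e_mem_fiber_orthogonal {n : ℕ∞} {i : ℕ} (h : n ≤ (i : ℕ∞)) : e i ∈ (fiber n)ᗮ := by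
  rw [Submodule.mem_orthogonal']
  intro v hv
  rw [inner_e, hv i h]

theorem star_mem_fiber {n : ℕ∞} {v : E} (h : v ∈ fiber n) : star v ∈ fiber n := by
  intro i hi
  rw [lp.star_apply, h i hi, star_zero]

theorem isClosed_fiber (n : ℕ∞) : IsClosed (fiber n : Set E) := by
  have : (fiber n : Set E) = ⋂ (i : ℕ) (_ : n ≤ (i : ℕ∞)), {v : E | inner ℂ (e i) v = 0} := by
    ext v
    simp [mem_fiber, inner_e]
  rw [this]
  exact isClosed_iInter fun i => isClosed_iInter fun _ =>
    isClosed_eq (continuous_const.inner continuous_id) continuous_const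

section Measurability

variable {α : Type*} [MeasurableSpace α] {μ : Measure α}

theorem aestronglyMeasurable_of_coord {F : α → E}
    (h : ∀ i, AEStronglyMeasurable (fun x => (F x : ℕ → ℂ) i) μ) : AEStronglyMeasurable F μ := by
  refine aestronglyMeasurable_of_tendsto_ae Filter.atTop
    (f := fun n x => ∑ i ∈ Finset.range n, (F x : ℕ → ℂ) i • e i) ?_ ?_
  · intro n
    exact Finset.aestronglyMeasurable_fun_sum _ fun i _ => (h i).smul aestronglyMeasurable_const
  · exact Filter.Eventually.of_forall fun x => (hasSum_e (F x)).tendsto_sum_nat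

theorem aestronglyMeasurable_coord {F : α → E} (h : AEStronglyMeasurable F μ) (i : ℕ) :
    AEStronglyMeasurable (fun x => (F x : ℕ → ℂ) i) μ := by
  have := (aestronglyMeasurable_const (b := e i) (μ := μ)).inner h (𝕜 := ℂ)
  simpa only [inner_e] using this

/-- `A x (F x)` is the pointwise limit of finite sums of coordinates of `F` times columns of `A`;
measurability of `A` in operator norm is not needed. -/
theorem aestronglyMeasurable_apply {A : α → E →L[ℂ] E} {F : α → E}
    (hA : ∀ i, AEStronglyMeasurable (fun x => A x (e i)) μ) (hF : AEStronglyMeasurable F μ) :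
    AEStronglyMeasurable (fun x => A x (F x)) μ := by
  refine aestronglyMeasurable_of_tendsto_ae Filter.atTop
    (f := fun n x => ∑ i ∈ Finset.range n, (F x : ℕ → ℂ) i • A x (e i)) ?_ ?_
  · intro n
    exact Finset.aestronglyMeasurable_fun_sum _ fun i _ =>
      (aestronglyMeasurable_coord hF i).smul (hA i)
  · refine Filter.Eventually.of_forall fun x => ?_
    have := ((hasSum_e (F x)).mapL (A x)).tendsto_sum_nat
    simpa only [map_smul] using this

theorem aestronglyMeasurable_adjoint {A : α → E →L[ℂ] E}
    (hA : ∀ i, AEStronglyMeasurable (fun x => A x (e i)) μ) (v : E) :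
    AEStronglyMeasurable (fun x => ContinuousLinearMap.adjoint (A x) v) μ := by
  refine aestronglyMeasurable_of_coord fun i => ?_
  have := (hA i).inner (aestronglyMeasurable_const (b := v)) (𝕜 := ℂ)
  refine this.congr (Filter.Eventually.of_forall fun x => ?_)
  simp only
  rw [← inner_e, ContinuousLinearMap.adjoint_inner_right]

end Measurability

/-! ### Representations of the Clifford algebra from anticommuting isometries -/

section Clifford

variable {Z : Type*} [NormedAddCommGroup Z] [InnerProductSpace ℝ Z]

theorem negForm_apply (v : Z) : negForm Z v = -‖v‖ ^ 2 := by
  simp [negForm]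

theorem rep_ext {ι : Type*} {w : ι → Z}
    (hd : (Submodule.span ℝ (Set.range w)).topologicalClosure = ⊤)
    {A : Type*} [Ring A] [Algebra ℝ A] [TopologicalSpace A] [T2Space A]
    {ρ ρ' : CliffordAlgebra (negForm Z) →ₐ[ℝ] A}
    (h : Continuous fun v : Z => ρ (CliffordAlgebra.ι (negForm Z) v))
    (h' : Continuous fun v : Z => ρ' (CliffordAlgebra.ι (negForm Z) v))
    (hw : ∀ i, ρ (CliffordAlgebra.ι (negForm Z) (w i)) =
      ρ' (CliffordAlgebra.ι (negForm Z) (w i))) : ρ = ρ' := by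
  apply CliffordAlgebra.hom_ext
  have hdense : Dense (Submodule.span ℝ (Set.range w) : Set Z) :=
    (Submodule.dense_iff_topologicalClosure_eq_top).2 hd
  ext1 v
  refine congrFun (Continuous.ext_on hdense h h' ?_) v
  have := LinearMap.eqOn_span (f := ρ.toLinearMap ∘ₗ CliffordAlgebra.ι (negForm Z))
    (g := ρ'.toLinearMap ∘ₗ CliffordAlgebra.ι (negForm Z)) (s := Set.range w) (by
      rintro _ ⟨i, rfl⟩
      exact hw i)
  exact this

variable {H : Type*} [NormedAddCommGroup H] [InnerProductSpace ℂ H]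

theorem inner_skew_of_sq {T : H →ₗᵢ[ℂ] H} (hT : ∀ f, T (T f) = -f) (f g : H) :
    inner ℂ (T f) g = -inner ℂ f (T g) := by
  have : g = -T (T g) := by rw [hT, neg_neg]
  conv_lhs => rw [this]
  rw [inner_neg_right, T.inner_map_map]

/-- The relations on the basis are bilinear, so they hold on its span. There the operators are skew
with square `-‖v‖²`, hence bounded, and extend continuously because `H` is complete; `Z` itself need
not be. -/
theorem exists_rep [CompleteSpace H] {ι : Type*} {w : ι → Z} (ho : Orthonormal ℝ w)
    (hd : (Submodule.span ℝ (Set.range w)).topologicalClosure = ⊤) (J : ι → H →ₗᵢ[ℂ] H)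
    (hsq : ∀ i f, J i (J i f) = -f) (hanti : ∀ i j, i ≠ j → ∀ f, J i (J j f) = -J j (J i f)) :
    ∃ ρ : CliffordAlgebra (negForm Z) →ₐ[ℝ] (H →L[ℂ] H),
      (Continuous fun v : Z => ρ (CliffordAlgebra.ι (negForm Z) v)) ∧
      ∀ i, ρ (CliffordAlgebra.ι (negForm Z) (w i)) = (J i).toContinuousLinearMap := by
  classical
  let S := Submodule.span ℝ (Set.range w)
  let B : Module.Basis ι ℝ S := Module.Basis.span ho.linearIndependent
  have hB : ∀ i, (B i : Z) = w i := fun i =>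
    congrArg Subtype.val (Module.Basis.span_apply ho.linearIndependent i)
  let L : S →ₗ[ℝ] (H →L[ℂ] H) := B.constr ℝ fun i => (J i).toContinuousLinearMap
  have hL : ∀ i, L (B i) = (J i).toContinuousLinearMap := fun i => B.constr_basis ℝ _ i
  have hind : ∀ {p : S → Prop}, p 0 → (∀ i, p (B i)) → (∀ v v', p v → p v' → p (v + v')) →
      (∀ (a : ℝ) v, p v → p (a • v)) → ∀ v, p v := by
    intro p h0 h1 h2 h3 v
    have hv : v ∈ Submodule.span ℝ (Set.range B) := by rw [B.span_eq]; trivial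
    induction hv using Submodule.span_induction with
    | mem x hx => obtain ⟨i, rfl⟩ := hx; exact h1 i
    | zero => exact h0
    | add x y _ _ hx hy => exact h2 x y hx hy
    | smul a x _ hx => exact h3 a x hx
  have hrel : ∀ v v' : S, L v * L v' + L v' * L v =
      (-2 * inner ℝ (v : Z) (v' : Z)) • (1 : H →L[ℂ] H) := by
    -- Induction over the basis in both arguments reduces the polarized relation to pairs of basis
    -- vectors.
    refine hind (by simp) (fun i => hind (by simp) (fun j => ?_) ?_ ?_) ?_ ?_
    · rw [hL, hL, hB, hB, orthonormal_iff_ite.1 ho]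
      ext1 f
      split_ifs with h
      · subst h
        change J i (J i f) + J i (J i f) = _
        rw [hsq]
        change _ = ((-2 * 1 : ℝ)) • f
        rw [mul_one, neg_smul, two_smul]
        abel
      · change J i (J j f) + J j (J i f) = _
        rw [hanti i j h]
        simp
    · intro v v' h h'
      rw [map_add, mul_add, add_mul, Submodule.coe_add, inner_add_right, mul_add, add_smul, ← h,
        ← h']
      abel
    · intro a v h
      rw [map_smul, Submodule.coe_smul, inner_smul_right, mul_left_comm, mul_smul, ← h, smul_add,
        mul_smul_comm, smul_mul_assoc]
    · intro v v' h h' u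
      rw [map_add, mul_add, add_mul, Submodule.coe_add, inner_add_left, mul_add, add_smul, ← h,
        ← h']
      abel
    · intro a v h u
      rw [map_smul, Submodule.coe_smul, real_inner_smul_left, mul_left_comm, mul_smul, ← h,
        smul_add, mul_smul_comm, smul_mul_assoc]
  have hsquare : ∀ v : S, L v * L v = (-‖(v : Z)‖ ^ 2) • (1 : H →L[ℂ] H) := by
    intro v
    have h := hrel v v
    rw [← two_smul ℝ, real_inner_self_eq_norm_sq, neg_mul, ← mul_neg, mul_smul] at h
    exact smul_right_injective _ (two_ne_zero (α := ℝ)) h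
  have hskew : ∀ (v : S) (f g : H), inner ℂ (L v f) g = -inner ℂ f (L v g) := by
    refine hind (by simp) (fun i f g => ?_) ?_ ?_
    · rw [hL]
      exact inner_skew_of_sq (hsq i) f g
    · intro v v' h h' f g
      rw [map_add, add_apply, add_apply, inner_add_left,
        inner_add_right, h, h', neg_add]
    · intro a v h f g
      rw [map_smul, smul_apply, smul_apply,
        inner_smul_left_eq_smul, inner_smul_right_eq_smul, h, smul_neg]
  -- Skewness and the square give `⟪L v f, L v f⟫ = -⟪f, L v (L v f)⟫ = ‖v‖² ‖f‖²`.
  have hnorm : ∀ v : S, ‖L v‖ ≤ 1 * ‖v‖ := by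
    intro v
    refine ContinuousLinearMap.opNorm_le_bound _ (by positivity) fun f => ?_
    have h1 : (inner ℂ (L v f) (L v f) : ℂ) = ((‖(v : Z)‖ ^ 2 * ‖f‖ ^ 2 : ℝ) : ℂ) := by
      rw [hskew]
      have : L v (L v f) = (-‖(v : Z)‖ ^ 2) • f := by
        have := congrArg (fun T : H →L[ℂ] H => T f) (hsquare v)
        exact this
      rw [this, inner_smul_right_eq_smul, inner_self_eq_norm_sq_to_K]
      simp
    rw [inner_self_eq_norm_sq_to_K] at h1
    have h2 : ‖L v f‖ ^ 2 = (‖(v : Z)‖ * ‖f‖) ^ 2 := by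
      rw [mul_pow]
      exact Complex.ofReal_injective (by simpa using h1)
    rw [one_mul]
    exact le_of_eq ((sq_eq_sq₀ (norm_nonneg _) (by positivity)).1 h2)
  let Lc : S →L[ℝ] (H →L[ℂ] H) := L.mkContinuous 1 hnorm
  have hdr : DenseRange S.subtypeL := by
    have hdense : Dense (S : Set Z) := (Submodule.dense_iff_topologicalClosure_eq_top).2 hd
    change Dense (Set.range ((↑) : S → Z))
    rwa [Subtype.range_coe]
  let K : Z →L[ℝ] (H →L[ℂ] H) := Lc.extend S.subtypeL
  have hK : ∀ v : S, K v = L v := fun v =>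
    Lc.extend_eq hdr (isUniformEmbedding_subtype_val.isUniformInducing) v
  have hKsq : ∀ v : Z, K v * K v = algebraMap ℝ (H →L[ℂ] H) (negForm Z v) := by
    intro v
    refine congrFun (hdr.equalizer (g := fun v => K v * K v)
      (h := fun v => algebraMap ℝ (H →L[ℂ] H) (negForm Z v)) (by fun_prop) ?_ ?_) v
    · simp only [negForm_apply, Algebra.algebraMap_eq_smul_one]
      fun_prop
    · ext1 v
      change K v * K v = algebraMap ℝ (H →L[ℂ] H) (negForm Z v)
      rw [hK, hsquare, negForm_apply, Algebra.algebraMap_eq_smul_one]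
  refine ⟨CliffordAlgebra.lift (negForm Z) ⟨K.toLinearMap, hKsq⟩, ?_, fun i => ?_⟩
  · simp only [CliffordAlgebra.lift_ι_apply]
    exact K.continuous
  · rw [CliffordAlgebra.lift_ι_apply]
    change K (w i) = _
    rw [← hB, hK, hL]

end Clifford

/-! ### Shifts and signs -/

theorem measurable_pi_map (g : ℕ → ZMod 2 → ZMod 2) : Measurable fun (x : X) k => g k (x k) :=
  measurable_pi_lambda _ fun k => (measurable_of_countable (g k)).comp (measurable_pi_apply k)

theorem measurable_shift (δ : X) : Measurable fun x : X => x + δ :=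
  measurable_pi_map fun k t => t + δ k

theorem add_delta_add_delta (x : X) (k : ℕ) : x + delta k + delta k = x := by
  have : delta k + delta k = 0 := funext fun j => CharTwo.add_self_eq_zero _
  rw [add_assoc, this, add_zero]

theorem involutive_shift (k : ℕ) : Function.Involutive fun x : X => x + delta k :=
  fun x => add_delta_add_delta x k

theorem involutive_refl : Function.Involutive fun x : X => 1 - x := fun x => by simp

theorem one_sub_add_delta (x : X) (k : ℕ) : 1 - x + delta k = 1 - (x + delta k) := by
  have : -delta k = delta k := funext fun j => CharTwo.neg_eq _
  rw [← sub_sub, sub_eq_add_neg (1 - x), this]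

theorem delta_mem_Delta (k : ℕ) : delta k ∈ Delta := by
  refine (Set.finite_singleton k).subset fun j hj => ?_
  by_contra h
  exact hj (Pi.single_eq_of_ne h _)

/-- The sign `(-1) ^ x_k`. -/
def sgn (k : ℕ) (x : X) : ℂ := (-1) ^ (x k).val

theorem measurable_sgn (k : ℕ) : Measurable (sgn k) :=
  (measurable_of_countable fun t : ZMod 2 => (-1 : ℂ) ^ t.val).comp (measurable_pi_apply k)

theorem sgn_mul_self (k : ℕ) (x : X) : sgn k x * sgn k x = 1 := by
  rw [sgn, ← pow_add, ← two_mul, pow_mul]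
  simp

theorem sgn_add_delta_self (k : ℕ) (x : X) : sgn k (x + delta k) = -sgn k x := by
  have h : ∀ t : ZMod 2, (-1 : ℂ) ^ (t + 1).val = -(-1) ^ t.val := by
    intro t
    fin_cases t
    · change (-1 : ℂ) ^ 1 = -(-1) ^ 0
      simp
    · change (-1 : ℂ) ^ 0 = -(-1) ^ 1
      simp
  simpa [sgn, delta] using h (x k)

theorem sgn_add_delta_of_ne {j k : ℕ} (h : j ≠ k) (x : X) : sgn j (x + delta k) = sgn j x := by
  simp [sgn, delta, Pi.single_eq_of_ne h]

theorem sgn_one_sub (k : ℕ) (x : X) : sgn k (1 - x) = -sgn k x := by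
  have h : ∀ t : ZMod 2, (-1 : ℂ) ^ (1 - t).val = -(-1) ^ t.val := by
    intro t
    fin_cases t
    · change (-1 : ℂ) ^ 1 = -(-1) ^ 0
      simp
    · change (-1 : ℂ) ^ 0 = -(-1) ^ 1
      simp
  exact h (x k)

theorem star_sgn (k : ℕ) (x : X) : star (sgn k x) = sgn k x := by simp [sgn]

/-- The sign `(-1) ^ (x_0 + ⋯ + x_{k-1})`. -/
def psgn (k : ℕ) (x : X) : ℂ := ∏ j ∈ Finset.range k, sgn j x

theorem measurable_psgn (k : ℕ) : Measurable (psgn k) :=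
  Finset.measurable_fun_prod _ fun j _ => measurable_sgn j

theorem psgn_eq (k : ℕ) (x : X) : (-1 : ℂ) ^ ((∑ j ∈ Finset.range k, (x j).val) + 1) =
    -psgn k x := by
  simp [psgn, sgn, Finset.prod_pow_eq_pow_sum, pow_succ]

theorem psgn_mul_self (k : ℕ) (x : X) : psgn k x * psgn k x = 1 := by
  rw [psgn, ← Finset.prod_mul_distrib]
  exact Finset.prod_eq_one fun j _ => sgn_mul_self j x

theorem psgn_add_delta_of_le {k l : ℕ} (h : k ≤ l) (x : X) : psgn k (x + delta l) = psgn k x :=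
  Finset.prod_congr rfl fun _ hj =>
    sgn_add_delta_of_ne ((Finset.mem_range.1 hj).trans_le h).ne x

theorem psgn_add_delta_of_lt {k l : ℕ} (h : l < k) (x : X) :
    psgn k (x + delta l) = -psgn k x := by
  have hl := Finset.mem_range.2 h
  rw [psgn, psgn, ← Finset.mul_prod_erase _ _ hl, ← Finset.mul_prod_erase _ _ hl,
    sgn_add_delta_self, neg_mul]
  congr 2
  exact Finset.prod_congr rfl fun j hj => sgn_add_delta_of_ne (Finset.ne_of_mem_erase hj) x

theorem psgn_one_sub (k : ℕ) (x : X) : psgn k (1 - x) = (-1) ^ k * psgn k x := by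
  simp [psgn, sgn_one_sub, Finset.prod_neg]

theorem star_psgn (k : ℕ) (x : X) : star (psgn k x) = psgn k x := by
  simp only [psgn, star_prod, star_sgn]

/-- The scalar factors of the operators of the basis vectors. -/
def coef : ℕ ⊕ ℕ → X → ℂ
  | .inl k, x => -psgn k x * Complex.I
  | .inr k, x => sgn k x * Complex.I * (-psgn k x * Complex.I)

/-- The coordinate that belongs to a basis vector. -/
def coordIdx : ℕ ⊕ ℕ → ℕ := Sum.elim id id

theorem measurable_coef (i : ℕ ⊕ ℕ) : Measurable (coef i) := by
  rcases i with k | k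
  · exact (measurable_psgn k).neg.mul_const _
  · exact ((measurable_sgn k).mul_const _).mul ((measurable_psgn k).neg.mul_const _)

theorem norm_eq_one_of_mul_self {a : ℂ} (h : a * a = 1) : ‖a‖ = 1 := by
  have := congrArg norm h
  rw [norm_mul, norm_one] at this
  nlinarith [norm_nonneg a]

theorem norm_coef (i : ℕ ⊕ ℕ) (x : X) : ‖coef i x‖ = 1 := by
  rcases i with k | k <;>
    simp [coef, norm_eq_one_of_mul_self (psgn_mul_self k x),
      norm_eq_one_of_mul_self (sgn_mul_self k x)]

/-- For `z_k` the sign comes from `i²`. For `σ z_k` the coefficient is the real sign `sgn k x * psgn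
k x`, and the shift flips its first factor. -/
theorem coef_mul_self (i : ℕ ⊕ ℕ) (x : X) :
    coef i x * coef i (x + delta (coordIdx i)) = -1 := by
  rcases i with k | k <;> simp only [coef, coordIdx, Sum.elim_inl, Sum.elim_inr, id]
  · rw [psgn_add_delta_of_le le_rfl]
    linear_combination (psgn k x * psgn k x) * Complex.I_mul_I - psgn_mul_self k x
  · rw [psgn_add_delta_of_le le_rfl, sgn_add_delta_self]
    have h : ∀ s p i : ℂ, s * i * (-p * i) * (-s * i * (-p * i)) = -(s * s) * (p * p) *
      ((i * i) * (i * i)) := by intros; ring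
    rw [h, sgn_mul_self, psgn_mul_self, Complex.I_mul_I]
    norm_num

/-- For different coordinates, only the partial sign of the larger index involves the other
coordinate, so exactly one of the two products changes sign. For `z_k` and `σ z_k` the change is
that of `sgn k` under the shift. -/
theorem coef_anticomm {i j : ℕ ⊕ ℕ} (h : i ≠ j) (x : X) :
    coef i x * coef j (x + delta (coordIdx i)) =
      -(coef j x * coef i (x + delta (coordIdx j))) := by
  rcases i with k | k <;> rcases j with l | l <;>
    simp only [coef, coordIdx, Sum.elim_inl, Sum.elim_inr, id, ne_eq, Sum.inl.injEq,
      Sum.inr.injEq] at h ⊢ <;>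
    rcases lt_trichotomy k l with hkl | hkl | hkl <;>
    first
    | exact absurd hkl h
    | (subst hkl
       simp only [psgn_add_delta_of_le le_rfl, sgn_add_delta_self]
       ring)
    | (simp only [psgn_add_delta_of_le hkl.le, psgn_add_delta_of_lt hkl,
        sgn_add_delta_of_ne hkl.ne, sgn_add_delta_of_ne hkl.ne']
       ring)

/-! ### Operators on the direct integral -/

theorem IsUnitaryOn.map_mem {F : Submodule ℂ E} {A : E →L[ℂ] E} (h : IsUnitaryOn F A) {v : E}
    (hv : v ∈ F) : A v ∈ F := by
  have := Submodule.mem_map_of_mem (f := (A : E →ₗ[ℂ] E)) hv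
  rwa [h.map_eq] at this

namespace Triple

variable (D : Triple)

instance : SigmaFinite D.μ := D.sigmaFinite

theorem quasi_shift (k : ℕ) : Measure.QuasiMeasurePreserving (fun x : X => x + delta k) D.μ D.μ :=
  ⟨measurable_shift _, (D.quasiInvariant _ (delta_mem_Delta k)).1⟩

theorem coe_mem_fiber (f : D.space) : ∀ᵐ x ∂D.μ, (f : Lp E 2 D.μ) x ∈ fiber (D.ν x) := f.2

variable {D}

theorem space_ext {f g : D.space}
    (h : ∀ᵐ x ∂D.μ, (f : Lp E 2 D.μ) x = (g : Lp E 2 D.μ) x) : f = g :=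
  Subtype.ext (Lp.ext h)

theorem exists_space {F : X → E} (hF : MemLp F 2 D.μ) (h : ∀ᵐ x ∂D.μ, F x ∈ fiber (D.ν x)) :
    ∃ f : D.space, ∀ᵐ x ∂D.μ, (f : Lp E 2 D.μ) x = F x := by
  refine ⟨⟨hF.toLp F, ?_⟩, hF.coeFn_toLp⟩
  filter_upwards [h, hF.coeFn_toLp] with x h1 h2
  rwa [h2]

theorem coe_add_ae (f g : D.space) : ∀ᵐ x ∂D.μ, ((f + g : D.space) : Lp E 2 D.μ) x =
    (f : Lp E 2 D.μ) x + (g : Lp E 2 D.μ) x := Lp.coeFn_add (f : Lp E 2 D.μ) (g : Lp E 2 D.μ)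

theorem coe_sub_ae (f g : D.space) : ∀ᵐ x ∂D.μ, ((f - g : D.space) : Lp E 2 D.μ) x =
    (f : Lp E 2 D.μ) x - (g : Lp E 2 D.μ) x := Lp.coeFn_sub (f : Lp E 2 D.μ) (g : Lp E 2 D.μ)

theorem coe_neg_ae (f : D.space) : ∀ᵐ x ∂D.μ, ((-f : D.space) : Lp E 2 D.μ) x =
    -(f : Lp E 2 D.μ) x := Lp.coeFn_neg (f : Lp E 2 D.μ)

theorem coe_smul_ae (a : ℂ) (f : D.space) : ∀ᵐ x ∂D.μ, ((a • f : D.space) : Lp E 2 D.μ) x =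
    a • (f : Lp E 2 D.μ) x := Lp.coeFn_smul a (f : Lp E 2 D.μ)

theorem aestronglyMeasurable_coe (f : D.space) :
    AEStronglyMeasurable (fun x => (f : Lp E 2 D.μ) x) D.μ :=
  Lp.aestronglyMeasurable (f : Lp E 2 D.μ)

/-- A convergent sequence in `L²` has a subsequence converging almost everywhere, and the fibres are
closed. -/
theorem isClosed_space : IsClosed (D.space : Set (Lp E 2 D.μ)) := by
  refine isClosed_of_closure_subset fun f hf => ?_
  obtain ⟨u, hu, hlim⟩ := mem_closure_iff_seq_limit.1 hf
  obtain ⟨ns, -, hns⟩ := (tendstoInMeasure_of_tendsto_Lp hlim).exists_seq_tendsto_ae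
  have hu' : ∀ᵐ x ∂D.μ, ∀ n, u n x ∈ fiber (D.ν x) := ae_all_iff.2 hu
  change ∀ᵐ x ∂D.μ, f x ∈ fiber (D.ν x)
  filter_upwards [hns, hu'] with x h1 h2
  exact (isClosed_fiber _).mem_of_tendsto h1 (Filter.Eventually.of_forall fun n => h2 _)

instance : CompleteSpace D.space := isClosed_space.completeSpace_coe

/-- A function whose pointwise norm is that of the weighted composition of `f` with `φ` is in the
direct integral, if its values are in the fibres, and has the norm of `f`. -/
theorem exists_space_of_norm {φ : X → X} (hq : Measure.QuasiMeasurePreserving φ D.μ D.μ)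
    (hi : Function.Involutive φ) (f : D.space) {F : X → E} (hF : AEStronglyMeasurable F D.μ)
    (hn : ∀ᵐ x ∂D.μ, ‖F x‖ = wt D.μ φ x * ‖(f : Lp E 2 D.μ) (φ x)‖)
    (h : ∀ᵐ x ∂D.μ, F x ∈ fiber (D.ν x)) :
    ∃ g : D.space, (∀ᵐ x ∂D.μ, (g : Lp E 2 D.μ) x = F x) ∧ ‖g‖ = ‖f‖ := by
  have he := eLpNorm_wt_mul hq hi (aestronglyMeasurable_coe f) hn
  have hm : MemLp F 2 D.μ := ⟨hF, by rw [he]; exact Lp.eLpNorm_lt_top _⟩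
  obtain ⟨g, hg⟩ := exists_space hm h
  refine ⟨g, hg, ?_⟩
  rw [Submodule.coe_norm, Submodule.coe_norm, Lp.norm_def, Lp.norm_def, ← he,
    eLpNorm_congr_ae hg]

theorem exists_isometry {φ : X → X} (hq : Measure.QuasiMeasurePreserving φ D.μ D.μ)
    (hi : Function.Involutive φ) {A : X → E →L[ℂ] E}
    (hm : ∀ i, AEStronglyMeasurable (fun x => A x (e i)) D.μ)
    (hA : ∀ᵐ x ∂D.μ, ∀ v ∈ fiber (D.ν (φ x)), A x v ∈ fiber (D.ν x) ∧ ‖A x v‖ = ‖v‖) :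
    ∃ T : D.space →ₗᵢ[ℂ] D.space, ∀ f : D.space, ∀ᵐ x ∂D.μ,
      (T f : Lp E 2 D.μ) x = A x (((wt D.μ φ x : ℝ) : ℂ) • (f : Lp E 2 D.μ) (φ x)) := by
  have key : ∀ f : D.space, ∃ g : D.space, (∀ᵐ x ∂D.μ, (g : Lp E 2 D.μ) x =
      A x (((wt D.μ φ x : ℝ) : ℂ) • (f : Lp E 2 D.μ) (φ x))) ∧ ‖g‖ = ‖f‖ := by
    intro f
    refine exists_space_of_norm hq hi f (aestronglyMeasurable_apply hm ?_) ?_ ?_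
    · exact (Complex.measurable_ofReal.comp
        (measurable_wt φ)).aestronglyMeasurable.smul
        ((aestronglyMeasurable_coe f).comp_quasiMeasurePreserving hq)
    · filter_upwards [hA, hq.ae (D.coe_mem_fiber f)] with x h1 h2
      rw [map_smul, norm_smul, (h1 _ h2).2, Complex.norm_real,
        Real.norm_of_nonneg (wt_nonneg _ _)]
    · filter_upwards [hA, hq.ae (D.coe_mem_fiber f)] with x h1 h2
      exact (h1 _ (Submodule.smul_mem _ _ h2)).1
  choose T hT hTn using key
  refine ⟨⟨⟨⟨T, fun f g => space_ext ?_⟩, fun a f => space_ext ?_⟩, hTn⟩, hT⟩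
  · filter_upwards [hT f, hT g, hT (f + g), coe_add_ae (T f) (T g), hq.ae (coe_add_ae f g)]
      with x h1 h2 h3 h4 h5
    rw [h3, h4, h5, h1, h2, smul_add, map_add]
  · filter_upwards [hT f, hT (a • f), coe_smul_ae a (T f), hq.ae (coe_smul_ae a f)]
      with x h1 h2 h3 h4
    simp only [RingHom.id_apply]
    rw [h2, h3, h4, h1, smul_comm, map_smul]

variable (D)

/-- The formula for the operator of a basis vector. -/
def basisFormula (i : ℕ ⊕ ℕ) (f : D.space) (x : X) : E :=
  coef i x • D.c (coordIdx i) x (((wt D.μ (fun y => y + delta (coordIdx i)) x : ℝ) : ℂ) •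
    (f : Lp E 2 D.μ) (x + delta (coordIdx i)))

theorem exists_basis_operator (i : ℕ ⊕ ℕ) : ∃ T : D.space →ₗᵢ[ℂ] D.space,
    ∀ f : D.space, ∀ᵐ x ∂D.μ, (T f : Lp E 2 D.μ) x = D.basisFormula i f x := by
  have hq := D.quasi_shift (coordIdx i)
  refine exists_isometry (φ := fun y => y + delta (coordIdx i)) (A := fun x =>
    coef i x • D.c (coordIdx i) x) hq (involutive_shift _) (fun j => ?_) ?_
  · exact (measurable_coef i).aestronglyMeasurable.smul (D.measurable_c _ _)
  · filter_upwards [D.unitary_c (coordIdx i), D.ν_add _ (delta_mem_Delta (coordIdx i))]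
      with x h1 h2 v hv
    rw [h2] at hv
    refine ⟨Submodule.smul_mem _ _ ?_, ?_⟩
    · exact h1.map_mem hv
    · rw [smul_apply, norm_smul, norm_coef, one_mul, h1.norm_map v hv]

variable {D}

theorem basis_operator_comp {i j : ℕ ⊕ ℕ} {S T : D.space → D.space}
    (hS : ∀ f : D.space, ∀ᵐ x ∂D.μ, (S f : Lp E 2 D.μ) x = D.basisFormula i f x)
    (hT : ∀ f : D.space, ∀ᵐ x ∂D.μ, (T f : Lp E 2 D.μ) x = D.basisFormula j f x) (f : D.space) :
    ∀ᵐ x ∂D.μ, (S (T f) : Lp E 2 D.μ) x = (coef i x * coef j (x + delta (coordIdx i))) •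
      ((wt D.μ (fun y => y + delta (coordIdx i)) x *
        wt D.μ (fun y => y + delta (coordIdx j)) (x + delta (coordIdx i)) : ℝ) : ℂ) •
      (D.c (coordIdx i) x ∘L D.c (coordIdx j) (x + delta (coordIdx i)))
        ((f : Lp E 2 D.μ) (x + delta (coordIdx i) + delta (coordIdx j))) := by
  filter_upwards [hS (T f), (D.quasi_shift (coordIdx i)).ae (hT f)] with x h1 h2
  rw [h1, basisFormula, h2, basisFormula]
  simp only [map_smul, ContinuousLinearMap.comp_apply, smul_smul, Complex.ofReal_mul]
  congr 1
  ring

theorem c_mul_c_shift (k : ℕ) : ∀ᵐ x ∂D.μ, ∀ v ∈ fiber (D.ν x),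
    D.c k x (D.c k (x + delta k) v) = v := by
  filter_upwards [D.adjoint_c k, D.unitary_c k, (D.quasi_shift k).ae (D.unitary_c k),
    D.ν_add _ (delta_mem_Delta k)] with x h1 h2 h3 h4 v hv
  rw [h4] at h3
  have hv' : D.c k (x + delta k) v ∈ fiber (D.ν x) := h3.map_mem hv
  -- With `c_k(x + δ_k)` the adjoint of `c_k(x)`, the cross term is `‖c_k(x + δ_k) v‖² = ‖v‖²`, so
  -- the squared distance expands to `0`.
  rw [← sub_eq_zero, ← norm_eq_zero, ← sq_eq_zero_iff, norm_sub_sq (𝕜 := ℂ), h2.norm_map _ hv',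
    h3.norm_map _ hv, ← ContinuousLinearMap.adjoint_inner_right, h1, inner_self_eq_norm_sq,
    h3.norm_map _ hv]
  ring

theorem basis_operator_sq {i : ℕ ⊕ ℕ} {T : D.space → D.space}
    (hT : ∀ f : D.space, ∀ᵐ x ∂D.μ, (T f : Lp E 2 D.μ) x = D.basisFormula i f x) (f : D.space) :
    T (T f) = -f := by
  refine space_ext ?_
  filter_upwards [basis_operator_comp hT hT f, coe_neg_ae f, D.coe_mem_fiber f,
    c_mul_c_shift (D := D) (coordIdx i),
    wt_mul_self (D.quasi_shift (coordIdx i)) (involutive_shift _)] with x h1 h2 h3 h4 h5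
  rw [h1, h2, coef_mul_self, h5, ContinuousLinearMap.comp_apply, add_delta_add_delta, h4 _ h3]
  simp

theorem basis_operator_anticomm {i j : ℕ ⊕ ℕ} (hij : i ≠ j) {S T : D.space → D.space}
    (hS : ∀ f : D.space, ∀ᵐ x ∂D.μ, (S f : Lp E 2 D.μ) x = D.basisFormula i f x)
    (hT : ∀ f : D.space, ∀ᵐ x ∂D.μ, (T f : Lp E 2 D.μ) x = D.basisFormula j f x) (f : D.space) :
    S (T f) = -T (S f) := by
  refine space_ext ?_
  filter_upwards [basis_operator_comp hS hT f, basis_operator_comp hT hS f, coe_neg_ae (T (S f)),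
    D.comm_c (coordIdx i) (coordIdx j), wt_mul_comm (D.quasi_shift (coordIdx i))
      (involutive_shift _) (D.quasi_shift (coordIdx j)) (involutive_shift _)
      (funext fun x => add_right_comm _ _ _)] with x h1 h2 h3 h4 h5
  rw [h3, h1, h2, coef_anticomm hij, h4, h5, add_right_comm x, neg_smul]

variable {Z : Type*} [NormedAddCommGroup Z] [InnerProductSpace ℝ Z]

theorem isRep_iff {b : Frame Z}
    {ρ : CliffordAlgebra (negForm Z) →ₐ[ℝ] (D.space →L[ℂ] D.space)} :
    D.IsRep b ρ ↔ (Continuous fun v : Z => ρ (CliffordAlgebra.ι (negForm Z) v)) ∧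
      ∀ (i : ℕ ⊕ ℕ) (f : D.space), ∀ᵐ x ∂D.μ,
        (ρ (CliffordAlgebra.ι (negForm Z) (Sum.elim b.z (fun k => b.σ (b.z k)) i)) f :
          Lp E 2 D.μ) x = D.basisFormula i f x := by
  have hz : ∀ k (f : D.space) x, ((-1 : ℂ) ^ ((∑ j ∈ Finset.range k, (x j).val) + 1) *
      Complex.I) • D.c k x (((√(D.shiftDensity k x) : ℝ) : ℂ) •
        (f : Lp E 2 D.μ) (x + delta k)) = D.basisFormula (.inl k) f x := by
    intro k f x
    rw [psgn_eq]
    rfl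
  have hσ : ∀ k (f : D.space) x, ((-1 : ℂ) ^ (x k).val * Complex.I) •
      D.basisFormula (.inl k) f x = D.basisFormula (.inr k) f x := by
    intro k f x
    rw [basisFormula, smul_smul]
    rfl
  constructor
  · intro h
    refine ⟨h.continuous, ?_⟩
    have h1 : ∀ k (f : D.space), ∀ᵐ x ∂D.μ,
        (ρ (CliffordAlgebra.ι (negForm Z) (b.z k)) f : Lp E 2 D.μ) x =
          D.basisFormula (.inl k) f x := by
      intro k f
      filter_upwards [h.apply_z k f] with x hx
      rw [hx, hz]
    rintro (k | k) f
    · exact h1 k f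
    · filter_upwards [h1 k f, h.apply_σz k f] with x h2 h3
      change (ρ (CliffordAlgebra.ι (negForm Z) (b.σ (b.z k))) f : Lp E 2 D.μ) x = _
      rw [h3, h2, hσ]
  · rintro ⟨hc, h⟩
    refine ⟨hc, fun k f => ?_, fun k f => ?_⟩
    · filter_upwards [h (.inl k) f] with x hx
      rw [hz]
      exact hx
    · filter_upwards [h (.inl k) f, h (.inr k) f] with x h1 h2
      change _ = _ at h1
      rw [Sum.elim_inl] at h1
      rw [h1, hσ]
      exact h2

theorem existsUnique_isRep (D : Triple) (b : Frame Z) : ∃! ρ, D.IsRep b ρ := by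
  choose J hJ using D.exists_basis_operator
  have hex : ∃ ρ : CliffordAlgebra (negForm Z) →ₐ[ℝ] (D.space →L[ℂ] D.space),
      (Continuous fun v : Z => ρ (CliffordAlgebra.ι (negForm Z) v)) ∧
      ∀ i, ρ (CliffordAlgebra.ι (negForm Z) (Sum.elim b.z (fun k => b.σ (b.z k)) i)) =
        (J i).toContinuousLinearMap :=
    exists_rep b.orthonormal b.dense J
      (fun i f => basis_operator_sq (T := J i) (hJ i) f)
      (fun i j hij f => basis_operator_anticomm (S := J i) (T := J j) hij (hJ i) (hJ j) f)
  obtain ⟨ρ, hc, hρ⟩ := hex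
  have hρJ : ∀ i (f : D.space), ∀ᵐ x ∂D.μ,
      (ρ (CliffordAlgebra.ι (negForm Z) (Sum.elim b.z (fun k => b.σ (b.z k)) i)) f :
        Lp E 2 D.μ) x = D.basisFormula i f x := by
    intro i f
    rw [hρ]
    exact hJ i f
  refine ⟨ρ, isRep_iff.2 ⟨hc, hρJ⟩, fun ρ' h' => ?_⟩
  obtain ⟨hc', hρ'⟩ := isRep_iff.1 h'
  refine rep_ext b.dense hc' hc fun i => ?_
  ext1 f
  refine space_ext ?_
  filter_upwards [hρ' i f, hρJ i f] with x h1 h2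
  exact h1.trans h2.symm

end Triple

/-! ### Real forms and conjugations -/

section RealForms

variable {H : Type*} [NormedAddCommGroup H] [InnerProductSpace ℂ H]

/-- The components are `(h + C h) / 2` and `-(i / 2) (h - C h)`. -/
theorem existsUnique_add_of_conj {C : H →ₛₗᵢ[starRingEnd ℂ] H} (hC : ∀ f, C (C f) = f)
    {V : Submodule ℝ H} (hV : ∀ f, f ∈ V ↔ C f = f) (h : H) :
    ∃! p : V × V, h = (p.1 : H) + Complex.I • (p.2 : H) := by
  have hfix : ∀ p q : V, C ((p : H) + Complex.I • (q : H)) = (p : H) - Complex.I • (q : H) := by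
    intro p q
    rw [map_add, LinearIsometry.map_smulₛₗ, (hV _).1 p.2, (hV _).1 q.2, Complex.conj_I, neg_smul,
      sub_eq_add_neg]
  have hhalf : (starRingEnd ℂ) (2⁻¹ : ℂ) = 2⁻¹ := by
    rw [map_inv₀, Complex.conj_ofNat]
  have h1 : (2⁻¹ : ℂ) • (h + C h) ∈ V := by
    rw [hV, LinearIsometry.map_smulₛₗ, map_add, hC, hhalf, add_comm h]
  have h2 : (-(2⁻¹ * Complex.I) : ℂ) • (h - C h) ∈ V := by
    rw [hV, LinearIsometry.map_smulₛₗ, map_sub, hC, map_neg, map_mul, hhalf, Complex.conj_I,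
      ← neg_sub h, smul_neg, ← neg_smul]
    congr 1
    ring
  refine ⟨(⟨_, h1⟩, ⟨_, h2⟩), ?_, ?_⟩
  · change h = (2⁻¹ : ℂ) • (h + C h) + Complex.I • (-(2⁻¹ * Complex.I) : ℂ) • (h - C h)
    have : Complex.I * (-(2⁻¹ * Complex.I)) = 2⁻¹ := by
      linear_combination (-(2⁻¹) : ℂ) * Complex.I_mul_I
    rw [smul_smul, this, ← smul_add]
    have h3 : h + C h + (h - C h) = (2 : ℂ) • h := by rw [two_smul]; abel
    rw [h3, smul_smul]
    norm_num
  · rintro ⟨p, q⟩ hpq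
    simp only at hpq
    have h3 := hfix p q
    rw [← hpq] at h3
    have hp : (p : H) = (2⁻¹ : ℂ) • (h + C h) := by
      rw [h3, hpq]
      have : (p : H) + Complex.I • (q : H) + ((p : H) - Complex.I • (q : H)) = (2 : ℂ) • (p : H) :=
        by rw [two_smul]; abel
      rw [this, smul_smul]
      norm_num
    have hq : (q : H) = (-(2⁻¹ * Complex.I) : ℂ) • (h - C h) := by
      rw [h3, hpq]
      have : (p : H) + Complex.I • (q : H) - ((p : H) - Complex.I • (q : H)) =
          (2 * Complex.I : ℂ) • (q : H) := by rw [mul_smul, two_smul]; abel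
      rw [this, smul_smul]
      have : (-(2⁻¹ * Complex.I)) * (2 * Complex.I) = 1 := by
        linear_combination (-1 : ℂ) * Complex.I_mul_I
      rw [this, one_smul]
    exact Prod.ext (Subtype.ext hp) (Subtype.ext hq)

/-- `C` exchanges `f + i g` and `f - i g`, so these have equal norm and the real part of `⟪f, i g⟫`
vanishes. -/
theorem inner_im_eq_zero_of_conj {C : H →ₛₗᵢ[starRingEnd ℂ] H} {f g : H} (hf : C f = f)
    (hg : C g = g) : (inner ℂ f g).im = 0 := by
  have h : ‖f + Complex.I • g‖ = ‖f - Complex.I • g‖ := by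
    rw [← C.norm_map (f + Complex.I • g), map_add, LinearIsometry.map_smulₛₗ, hf, hg,
      Complex.conj_I, neg_smul, sub_eq_add_neg]
  have h1 := norm_add_sq (𝕜 := ℂ) f (Complex.I • g)
  rw [h, norm_sub_sq (𝕜 := ℂ), inner_smul_right] at h1
  have h2 : RCLike.re (Complex.I * inner ℂ f g) = -(inner ℂ f g).im := by simp
  rw [h2] at h1
  linarith

/-- Take `C (p + i q) = p - i q` for `p`, `q` in `V`. Realness of the inner product on `V` makes it
isometric, and invariance of `V` makes it commute with `ρ`. -/
theorem exists_conj_of_realForm {Z : Type*} [NormedAddCommGroup Z] [InnerProductSpace ℝ Z]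
    {ρ : CliffordAlgebra (negForm Z) →ₐ[ℝ] (H →L[ℂ] H)} {V : Submodule ℝ H}
    (h : IsInvariantRealForm ρ V) : ∃ C : H →ₛₗᵢ[starRingEnd ℂ] H, (∀ f, C (C f) = f) ∧
      (∀ f, f ∈ V ↔ C f = f) ∧ ∀ a f, C (ρ a f) = ρ a (C f) := by
  have hex := fun f => (h.existsUnique_add f).exists
  choose P hP using hex
  have huniq : ∀ f (p q : H), p ∈ V → q ∈ V → f = p + Complex.I • q →
      ((P f).1 : H) = p ∧ ((P f).2 : H) = q := by
    intro f p q hp hq hf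
    have := (h.existsUnique_add f).unique (hP f) (y₂ := (⟨p, hp⟩, ⟨q, hq⟩)) hf
    rw [this]
    exact ⟨rfl, rfl⟩
  let C : H → H := fun f => (P f).1 - Complex.I • ((P f).2 : H)
  have hC : ∀ p q : H, p ∈ V → q ∈ V → C (p + Complex.I • q) = p - Complex.I • q := by
    intro p q hp hq
    obtain ⟨h1, h2⟩ := huniq _ p q hp hq rfl
    simp only [C, h1, h2]
  have hadd : ∀ f g, C (f + g) = C f + C g := by
    intro f g
    have hfg : f + g = ((P f).1 + (P g).1 : H) + Complex.I • ((P f).2 + (P g).2 : H) := by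
      conv_lhs => rw [hP f, hP g]
      rw [smul_add]
      abel
    rw [hfg, hC _ _ (V.add_mem (P f).1.2 (P g).1.2) (V.add_mem (P f).2.2 (P g).2.2)]
    simp only [C, smul_add]
    abel
  have hsmul : ∀ (a : ℂ) f, C (a • f) = (starRingEnd ℂ) a • C f := by
    intro a f
    have haf : a • f = (a.re • ((P f).1 : H) - a.im • ((P f).2 : H)) +
        Complex.I • (a.re • ((P f).2 : H) + a.im • ((P f).1 : H)) := by
      conv_lhs => rw [hP f, ← Complex.re_add_im a]
      simp only [← Complex.coe_smul]
      match_scalars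
      · ring
      · linear_combination (a.im : ℂ) * Complex.I_mul_I
    rw [haf, hC _ _ (V.sub_mem (V.smul_mem _ (P f).1.2) (V.smul_mem _ (P f).2.2))
      (V.add_mem (V.smul_mem _ (P f).2.2) (V.smul_mem _ (P f).1.2))]
    have hconj : (starRingEnd ℂ) a = (a.re : ℂ) - a.im * Complex.I := by
      apply Complex.ext <;> simp
    simp only [C, hconj, ← Complex.coe_smul]
    match_scalars
    · ring
    · linear_combination (-(a.im : ℂ)) * Complex.I_mul_I
  have hnorm : ∀ f, ‖C f‖ = ‖f‖ := by
    intro f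
    have him := h.inner_real _ (P f).1.2 _ (P f).2.2
    have hre : RCLike.re (inner ℂ ((P f).1 : H) (Complex.I • ((P f).2 : H))) = 0 := by
      rw [inner_smul_right]
      simpa using him
    refine (sq_eq_sq₀ (norm_nonneg _) (norm_nonneg _)).1 ?_
    conv_rhs => rw [hP f]
    rw [norm_sub_sq (𝕜 := ℂ), norm_add_sq (𝕜 := ℂ), hre]
    ring
  refine ⟨⟨⟨⟨C, hadd⟩, hsmul⟩, hnorm⟩, fun f => ?_, fun f => ⟨fun hf => ?_, fun hf => ?_⟩,
    fun a f => ?_⟩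
  · change C (C f) = f
    have h1 : C f = (P f).1 + Complex.I • (-(P f).2 : H) := by
      simp only [C]
      rw [smul_neg, sub_eq_add_neg]
    rw [h1, hC _ _ (P f).1.2 (V.neg_mem (P f).2.2), smul_neg, sub_neg_eq_add]
    exact (hP f).symm
  · change C f = f
    have := hC f 0 hf V.zero_mem
    simpa using this
  · change C f = f at hf
    have h1 : Complex.I • ((P f).2 : H) = 0 := by
      have h2 : ((P f).1 : H) - Complex.I • ((P f).2 : H) =
        (P f).1 + Complex.I • ((P f).2 : H) := hf.trans (hP f)
      have h3 : (2 : ℂ) • Complex.I • ((P f).2 : H) = 0 := by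
        rw [two_smul, ← sub_eq_zero.2 h2.symm]
        abel
      simpa using h3
    rw [hP f, h1, add_zero]
    exact (P f).1.2
  · change C (ρ a f) = ρ a (C f)
    conv_lhs => rw [hP f]
    rw [map_add, map_smul, hC _ _ (h.invariant a _ (P f).1.2) (h.invariant a _ (P f).2.2)]
    simp only [C, map_sub, map_smul]

theorem invariant_of_dense {Z : Type*} [NormedAddCommGroup Z] [InnerProductSpace ℝ Z]
    {ι : Type*} {w : ι → Z} (hd : (Submodule.span ℝ (Set.range w)).topologicalClosure = ⊤)
    {ρ : CliffordAlgebra (negForm Z) →ₐ[ℝ] (H →L[ℂ] H)}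
    (hc : Continuous fun v : Z => ρ (CliffordAlgebra.ι (negForm Z) v))
    {V : Submodule ℝ H} (hV : IsClosed (V : Set H))
    (hw : ∀ i, ∀ f ∈ V, ρ (CliffordAlgebra.ι (negForm Z) (w i)) f ∈ V) :
    ∀ a, ∀ f ∈ V, ρ a f ∈ V := by
  intro a
  induction a using CliffordAlgebra.induction with
  | algebraMap r =>
    intro f hf
    rw [AlgHom.commutes]
    exact V.smul_mem r hf
  | ι v =>
    intro f hf
    have hcl : IsClosed {v : Z | ρ (CliffordAlgebra.ι (negForm Z) v) f ∈ V} :=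
      hV.preimage ((ContinuousLinearMap.apply ℂ H f).continuous.comp hc)
    have hdense : Dense (Submodule.span ℝ (Set.range w) : Set Z) :=
      (Submodule.dense_iff_topologicalClosure_eq_top).2 hd
    have hsub : (Submodule.span ℝ (Set.range w) : Set Z) ⊆
        {v : Z | ρ (CliffordAlgebra.ι (negForm Z) v) f ∈ V} := by
      intro v hv
      induction hv using Submodule.span_induction with
      | mem v hv =>
        obtain ⟨i, rfl⟩ := hv
        exact hw i f hf
      | zero => simp
      | add v v' _ _ hv hv' =>
        have := V.add_mem hv hv'
        simpa using this
      | smul r v _ hv =>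
        have := V.smul_mem r hv
        simpa using this
    exact hcl.closure_subset_iff.2 hsub (hdense v)
  | mul a a' ha ha' =>
    intro f hf
    rw [map_mul]
    exact ha _ (ha' f hf)
  | add a a' ha ha' =>
    intro f hf
    rw [map_add]
    exact V.add_mem (ha f hf) (ha' f hf)

end RealForms

/-! ### The standard conjugation and its real form -/

/-- Reflection contributes `(-1)^k` through the partial sign. The additional sign comes from
conjugating `i` for `z_k`, and from reflecting `sgn k` for `σ z_k`, so one exponent serves both. -/
theorem star_coef (i : ℕ ⊕ ℕ) (x : X) :
    star (coef i x) * (-1) ^ (coordIdx i + 1) = coef i (1 - x) := by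
  have hI : star Complex.I = -Complex.I := Complex.conj_I
  rcases i with k | k <;>
    simp only [coef, coordIdx, Sum.elim_inl, Sum.elim_inr, id, star_mul', star_neg, star_psgn,
      star_sgn, hI, psgn_one_sub, sgn_one_sub, pow_succ] <;> ring

namespace Triple

variable {D : Triple}

theorem exists_refl_conj (hq : Measure.QuasiMeasurePreserving (fun x : X => 1 - x) D.μ D.μ)
    (hν : ∀ᵐ x ∂D.μ, D.ν (1 - x) = D.ν x) :
    ∃ C : D.space →ₛₗᵢ[starRingEnd ℂ] D.space, ∀ f : D.space, ∀ᵐ x ∂D.μ,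
      (C f : Lp E 2 D.μ) x =
        ((wt D.μ (fun x => 1 - x) x : ℝ) : ℂ) • star ((f : Lp E 2 D.μ) (1 - x)) := by
  have key : ∀ f : D.space, ∃ g : D.space, (∀ᵐ x ∂D.μ, (g : Lp E 2 D.μ) x =
      ((wt D.μ (fun x => 1 - x) x : ℝ) : ℂ) • star ((f : Lp E 2 D.μ) (1 - x))) ∧ ‖g‖ = ‖f‖ := by
    intro f
    refine exists_space_of_norm hq involutive_refl f ?_ ?_ ?_
    · exact (Complex.measurable_ofReal.comp (measurable_wt _)).aestronglyMeasurable.smul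
        ((aestronglyMeasurable_coe f).comp_quasiMeasurePreserving hq).star
    · refine Filter.Eventually.of_forall fun x => ?_
      rw [norm_smul, norm_star, Complex.norm_real, Real.norm_of_nonneg (wt_nonneg _ _)]
    · filter_upwards [hq.ae (D.coe_mem_fiber f), hν] with x h1 h2
      rw [h2] at h1
      exact Submodule.smul_mem _ _ (star_mem_fiber h1)
  choose T hT hTn using key
  refine ⟨⟨⟨⟨T, fun f g => space_ext ?_⟩, fun a f => space_ext ?_⟩, hTn⟩, hT⟩
  · filter_upwards [hT f, hT g, hT (f + g), coe_add_ae (T f) (T g), hq.ae (coe_add_ae f g)]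
      with x h1 h2 h3 h4 h5
    rw [h3, h4, h5, h1, h2, star_add, smul_add]
  · filter_upwards [hT f, hT (a • f), coe_smul_ae ((starRingEnd ℂ) a) (T f),
      hq.ae (coe_smul_ae a f)] with x h1 h2 h3 h4
    rw [h2, h3, h4, h1, star_smul, smul_comm]
    rfl

theorem refl_conj_conj (hq : Measure.QuasiMeasurePreserving (fun x : X => 1 - x) D.μ D.μ)
    {C : D.space → D.space} (hC : ∀ f : D.space, ∀ᵐ x ∂D.μ, (C f : Lp E 2 D.μ) x =
      ((wt D.μ (fun x => 1 - x) x : ℝ) : ℂ) • star ((f : Lp E 2 D.μ) (1 - x))) (f : D.space) :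
    C (C f) = f := by
  refine space_ext ?_
  filter_upwards [hC (C f), hq.ae (hC f), wt_mul_self hq involutive_refl] with x h1 h2 h3
  rw [h1, h2, star_smul, star_star, smul_smul]
  have hstar : ∀ r : ℝ, star (r : ℂ) = r := Complex.conj_ofReal
  rw [hstar, ← Complex.ofReal_mul, h3, sub_sub_cancel]
  simp

theorem IsStandard.mem_realForm_iff (h : D.IsStandard) {f : D.space} :
    f ∈ h.realForm ↔ ∀ᵐ x ∂D.μ, star ((f : Lp E 2 D.μ) x) =
      ((wt D.μ (fun x => 1 - x) x : ℝ) : ℂ) • (f : Lp E 2 D.μ) (1 - x) := Iff.rfl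

theorem IsStandard.mem_realForm_iff_conj (h : D.IsStandard) {C : D.space → D.space}
    (hC : ∀ f : D.space, ∀ᵐ x ∂D.μ, (C f : Lp E 2 D.μ) x =
      ((wt D.μ (fun x => 1 - x) x : ℝ) : ℂ) • star ((f : Lp E 2 D.μ) (1 - x))) (f : D.space) :
    f ∈ h.realForm ↔ C f = f := by
  have hstar : ∀ r : ℝ, star (r : ℂ) = r := Complex.conj_ofReal
  rw [h.mem_realForm_iff]
  constructor
  · intro hf
    refine space_ext ?_
    filter_upwards [hf, hC f] with x h1 h2
    rw [h2, ← star_star ((f : Lp E 2 D.μ) x), h1, star_smul, hstar]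
  · intro hf
    have := hC f
    rw [hf] at this
    filter_upwards [this] with x h1
    rw [h1, star_smul, star_star, hstar]

theorem IsStandard.isClosed_realForm (h : D.IsStandard) :
    IsClosed (h.realForm : Set D.space) := by
  obtain ⟨C, hC⟩ := exists_refl_conj h.quasi h.ν_refl
  have : (h.realForm : Set D.space) = {f | C f = f} := by
    ext f
    exact h.mem_realForm_iff_conj hC f
  rw [this]
  exact isClosed_eq C.continuous continuous_id

/-- The signs of `c_refl` and `star_coef` cancel, and the weights agree because the shift and the
reflection commute. -/
theorem IsStandard.basis_operator_mem (h : D.IsStandard) {i : ℕ ⊕ ℕ} {f g : D.space}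
    (hf : f ∈ h.realForm)
    (hg : ∀ᵐ x ∂D.μ, (g : Lp E 2 D.μ) x = D.basisFormula i f x) : g ∈ h.realForm := by
  rw [h.mem_realForm_iff] at hf ⊢
  have hstar : ∀ r : ℝ, star (r : ℂ) = r := Complex.conj_ofReal
  have hq := D.quasi_shift (coordIdx i)
  filter_upwards [hg, h.quasi.ae hg, h.quasi.ae (h.c_refl (coordIdx i)), hq.ae hf,
    wt_mul_comm h.quasi involutive_refl hq (involutive_shift _)
      (funext fun x => (one_sub_add_delta _ _).symm)] with x h1 h2 h3 h4 h5
  rw [sub_sub_cancel] at h3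
  have h6 : ∀ v, star (D.c (coordIdx i) x v) =
      (-1 : ℂ) ^ (coordIdx i + 1) • D.c (coordIdx i) (1 - x) (star v) := by
    intro v
    rw [← h3, star_star]
  rw [h1, h2, basisFormula, basisFormula, star_smul, h6, star_smul, h4, hstar, ← star_coef,
    one_sub_add_delta]
  simp only [map_smul, smul_smul]
  congr 1
  have h7 := congrArg (fun r : ℝ => (r : ℂ)) h5
  simp only [Complex.ofReal_mul] at h7
  linear_combination (-(star (coef i x) * (-1) ^ (coordIdx i + 1))) * h7

variable {Z : Type*} [NormedAddCommGroup Z] [InnerProductSpace ℝ Z]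

theorem IsStandard.isInvariantRealForm (h : D.IsStandard) {b : Frame Z}
    {ρ : CliffordAlgebra (negForm Z) →ₐ[ℝ] (D.space →L[ℂ] D.space)} (hρ : D.IsRep b ρ) :
    IsInvariantRealForm ρ h.realForm := by
  obtain ⟨C, hC⟩ := exists_refl_conj h.quasi h.ν_refl
  obtain ⟨hc, hb⟩ := isRep_iff.1 hρ
  have hmem := h.mem_realForm_iff_conj hC
  exact ⟨invariant_of_dense b.dense hc h.isClosed_realForm
      fun i f hf => h.basis_operator_mem hf (hb i f),
    existsUnique_add_of_conj (refl_conj_conj h.quasi hC) hmem,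
    fun f hf g hg => inner_im_eq_zero_of_conj ((hmem f).1 hf) ((hmem g).1 hg)⟩

end Triple

/-! ### Conjugations of the direct integral that commute with the representation -/

namespace Triple

variable {D : Triple}

theorem exists_indicator {S : Set X} (hS : MeasurableSet S) (f : D.space) :
    ∃ g : D.space, ∀ᵐ x ∂D.μ, (g : Lp E 2 D.μ) x = S.indicator (f : Lp E 2 D.μ) x := by
  refine exists_space ((Lp.memLp (f : Lp E 2 D.μ)).indicator hS) ?_
  filter_upwards [D.coe_mem_fiber f] with x hx
  by_cases h : x ∈ S
  · rwa [Set.indicator_of_mem h]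
  · rw [Set.indicator_of_notMem h]
    exact Submodule.zero_mem _

theorem lintegral_enorm_sq (f : D.space) : ∫⁻ x, ‖(f : Lp E 2 D.μ) x‖ₑ ^ 2 ∂D.μ = ‖f‖ₑ ^ 2 := by
  have h : ‖f‖ₑ = eLpNorm (f : Lp E 2 D.μ) 2 D.μ := Lp.enorm_def (f : Lp E 2 D.μ)
  rw [h, eLpNorm_eq_lintegral_rpow_enorm_toReal (by simp) (by simp), ENNReal.toReal_ofNat,
    ← ENNReal.rpow_natCast, ← ENNReal.rpow_mul]
  norm_num

theorem measurable_enorm_sq (f : D.space) : Measurable fun x => ‖(f : Lp E 2 D.μ) x‖ₑ ^ 2 :=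
  (Lp.stronglyMeasurable (f : Lp E 2 D.μ)).enorm.pow_const 2

theorem setLIntegral_enorm_sq {S : Set X} (hS : MeasurableSet S) {f g : D.space}
    (h : ∀ᵐ x ∂D.μ, (g : Lp E 2 D.μ) x = S.indicator (f : Lp E 2 D.μ) x) :
    ∫⁻ x in S, ‖(f : Lp E 2 D.μ) x‖ₑ ^ 2 ∂D.μ = ‖g‖ₑ ^ 2 := by
  rw [← lintegral_enorm_sq, ← lintegral_indicator hS]
  refine lintegral_congr_ae ?_
  filter_upwards [h] with x hx
  rw [hx]
  by_cases h : x ∈ S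
  · simp [h]
  · simp [h]

/-- `T S` is multiplication by `-i sgn k`. It commutes with `C`, while `C` conjugates the factor
`-i`; hence the sign. -/
theorem sgn_conj {k : ℕ} {S T : D.space → D.space}
    (hS : ∀ f : D.space, ∀ᵐ x ∂D.μ, (S f : Lp E 2 D.μ) x = D.basisFormula (.inl k) f x)
    (hT : ∀ f : D.space, ∀ᵐ x ∂D.μ, (T f : Lp E 2 D.μ) x = D.basisFormula (.inr k) f x)
    {C : D.space →ₛₗᵢ[starRingEnd ℂ] D.space} (hCS : ∀ f, C (S f) = S (C f))
    (hCT : ∀ f, C (T f) = T (C f)) {f g : D.space}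
    (hg : ∀ᵐ x ∂D.μ, (g : Lp E 2 D.μ) x = sgn k x • (f : Lp E 2 D.μ) x) :
    ∀ᵐ x ∂D.μ, (C g : Lp E 2 D.μ) x = -sgn k x • (C f : Lp E 2 D.μ) x := by
  have key : ∀ f : D.space, ∀ᵐ x ∂D.μ, (T (S f) : Lp E 2 D.μ) x =
      (-Complex.I * sgn k x) • (f : Lp E 2 D.μ) x := by
    intro f
    filter_upwards [hS (S f), hT (S f), coe_neg_ae f] with x h1 h2 h3
    rw [basis_operator_sq hS, h3] at h1
    have h4 : D.basisFormula (.inr k) (S f) x =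
        (sgn k x * Complex.I) • D.basisFormula (.inl k) (S f) x := by
      rw [basisFormula, basisFormula, smul_smul]
      rfl
    rw [h2, h4, ← h1, smul_neg, ← neg_smul]
    congr 1
    ring
  have h1 : T (S f) = -Complex.I • g := by
    refine space_ext ?_
    filter_upwards [key f, coe_smul_ae (-Complex.I) g, hg] with x h1 h2 h3
    rw [h1, h2, h3, smul_smul]
  have h2 : T (S (C f)) = Complex.I • C g := by
    rw [← hCS, ← hCT, h1, LinearIsometry.map_smulₛₗ, map_neg, Complex.conj_I, neg_neg]
  have h3 := key (C f)
  rw [h2] at h3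
  filter_upwards [h3, coe_smul_ae Complex.I (C g)] with x h4 h5
  rw [h5, neg_mul, ← mul_neg, mul_smul] at h4
  exact smul_right_injective _ Complex.I_ne_zero h4

/-- The sets whose restriction operators are carried by `C` to those of the reflected sets. -/
def reflSets (C : D.space → D.space) : Set (Set X) :=
  {S | MeasurableSet S ∧ ∀ f g : D.space,
    (∀ᵐ x ∂D.μ, (g : Lp E 2 D.μ) x = S.indicator (f : Lp E 2 D.μ) x) →
    ∀ᵐ x ∂D.μ, (C g : Lp E 2 D.μ) x =
      ((fun x => 1 - x) ⁻¹' S).indicator (C f : Lp E 2 D.μ) x}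

theorem isPiSystem_reflSets (C : D.space → D.space) : IsPiSystem (reflSets C) := by
  rintro S ⟨hS, hS'⟩ T ⟨hT, hT'⟩ -
  refine ⟨hS.inter hT, fun f g hg => ?_⟩
  obtain ⟨g', hg'⟩ := exists_indicator hT f
  have h1 := hS' g' g (by
    filter_upwards [hg, hg'] with x h1 h2
    rw [h1, ← Set.indicator_indicator]
    by_cases h : x ∈ S
    · rw [Set.indicator_of_mem h, Set.indicator_of_mem h, h2]
    · rw [Set.indicator_of_notMem h, Set.indicator_of_notMem h])
  filter_upwards [h1, hT' f g' hg'] with x h1 h2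
  rw [h1, Set.preimage_inter, ← Set.indicator_indicator]
  by_cases h : x ∈ (fun x : X => 1 - x) ⁻¹' S
  · rw [Set.indicator_of_mem h, Set.indicator_of_mem h, h2]
  · rw [Set.indicator_of_notMem h, Set.indicator_of_notMem h]

theorem measurable_refl : Measurable fun x : X => 1 - x := measurable_pi_map fun _ t => 1 - t

theorem zmod_two_cases (t : ZMod 2) : t = 0 ∨ t = 1 := by
  fin_cases t
  · exact Or.inl rfl
  · exact Or.inr rfl

theorem sgn_of_eq_zero {k : ℕ} {x : X} (h : x k = 0) : sgn k x = 1 := by simp [sgn, h]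

theorem sgn_of_eq_one {k : ℕ} {x : X} (h : x k = 1) : sgn k x = -1 := by
  rw [sgn, h]
  change (-1 : ℂ) ^ 1 = -1
  simp

theorem coord_mem_reflSets {k : ℕ} {C : D.space →ₛₗᵢ[starRingEnd ℂ] D.space}
    (hC : ∀ f g : D.space, (∀ᵐ x ∂D.μ, (g : Lp E 2 D.μ) x = sgn k x • (f : Lp E 2 D.μ) x) →
      ∀ᵐ x ∂D.μ, (C g : Lp E 2 D.μ) x = -sgn k x • (C f : Lp E 2 D.μ) x) :
    {x : X | x k = 0} ∈ reflSets C := by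
  refine ⟨measurable_pi_apply k (measurableSet_singleton 0), fun f g hg => ?_⟩
  -- The indicator of `{x | x k = 0}` is `(1 + sgn k) / 2`, so `2 g - f` is `sgn k` times `f`;
  -- changing the sign of `sgn k` yields the indicator of the reflected set.
  have h1 := hC f ((2 : ℂ) • g - f) (by
    filter_upwards [hg, coe_sub_ae ((2 : ℂ) • g) f, coe_smul_ae 2 g] with x h1 h2 h3
    rw [h2, h3, h1]
    rcases zmod_two_cases (x k) with h | h
    · rw [Set.indicator_of_mem (by exact h), sgn_of_eq_zero h, two_smul]
      simp
    · rw [Set.indicator_of_notMem (by simp [h]), sgn_of_eq_one h]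
      simp)
  rw [map_sub, LinearIsometry.map_smulₛₗ, Complex.conj_ofNat] at h1
  filter_upwards [h1, coe_sub_ae ((2 : ℂ) • C g) (C f), coe_smul_ae 2 (C g)] with x h1 h2 h3
  rw [h2, h3, sub_eq_iff_eq_add] at h1
  refine smul_right_injective _ (two_ne_zero (α := ℂ)) ?_
  simp only
  rw [h1]
  rcases zmod_two_cases (x k) with h | h
  · rw [Set.indicator_of_notMem (by simp [h]), sgn_of_eq_zero h]
    simp
  · rw [Set.indicator_of_mem (by simp [h]), sgn_of_eq_one h, two_smul]
    simp

theorem generateFrom_eq_of_coord {G : Set (Set X)} (h1 : ∀ S ∈ G, MeasurableSet S)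
    (h2 : ∀ k, {x : X | x k = 0} ∈ G) :
    (inferInstance : MeasurableSpace X) = MeasurableSpace.generateFrom G := by
  refine le_antisymm ?_ (MeasurableSpace.generateFrom_le h1)
  refine iSup_le fun k => ?_
  rw [← measurable_iff_comap_le]
  have h0 : MeasurableSet[MeasurableSpace.generateFrom G] {x : X | x k = 0} :=
    MeasurableSpace.measurableSet_generateFrom (h2 k)
  refine @measurable_to_countable' _ _ _ _ (MeasurableSpace.generateFrom G) _ fun t => ?_
  rcases zmod_two_cases t with rfl | rfl
  · exact h0
  · convert h0.compl using 1
    ext x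
    rcases zmod_two_cases (x k) with h | h <;> simp [h]

/-- Both measures are finite. They agree on `reflSets C`, where they compute norms of restrictions
of `f` and of their images under the isometry `C`; this π-system contains the coordinate sets and so
generates the σ-algebra. -/
theorem map_withDensity_conj {C : D.space →ₛₗᵢ[starRingEnd ℂ] D.space}
    (hC : ∀ k, {x : X | x k = 0} ∈ reflSets C) (f : D.space) :
    (D.μ.withDensity fun x => ‖(C f : Lp E 2 D.μ) x‖ₑ ^ 2).map (fun x => 1 - x) =
      D.μ.withDensity fun x => ‖(f : Lp E 2 D.μ) x‖ₑ ^ 2 := by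
  have hfin : ∀ f : D.space,
      IsFiniteMeasure (D.μ.withDensity fun x => ‖(f : Lp E 2 D.μ) x‖ₑ ^ 2) := by
    intro f
    refine isFiniteMeasure_withDensity ?_
    rw [lintegral_enorm_sq]
    simp
  have := hfin f
  have := hfin (C f)
  have hn : ∀ f, ‖C f‖ₑ = ‖f‖ₑ := fun f => by rw [← ofReal_norm, ← ofReal_norm, C.norm_map]
  refine ext_of_generate_finite _ (generateFrom_eq_of_coord (fun S hS => hS.1) hC)
    (isPiSystem_reflSets C) ?_ ?_
  · rintro S ⟨hS, hS'⟩
    obtain ⟨g, hg⟩ := exists_indicator hS f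
    rw [Measure.map_apply measurable_refl hS, withDensity_apply _ (measurable_refl hS),
      withDensity_apply _ hS, setLIntegral_enorm_sq hS hg,
      setLIntegral_enorm_sq (measurable_refl hS) (hS' f g hg), hn]
  · rw [Measure.map_apply measurable_refl MeasurableSet.univ, Set.preimage_univ,
      withDensity_apply _ MeasurableSet.univ, withDensity_apply _ MeasurableSet.univ,
      Measure.restrict_univ, lintegral_enorm_sq, lintegral_enorm_sq, hn]

/-! ### Measurable frames and equivalence of the reflected measure -/

theorem measurableSet_lt_ν (D : Triple) (i : ℕ) : MeasurableSet {x | (i : ℕ∞) < D.ν x} :=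
  D.measurable_ν (Set.Ioi (i : ℕ∞)).to_countable.measurableSet

/-- Since `μ` need not be finite, constant sections are scaled by a positive square-integrable `h`.
Almost everywhere identities tested on these countably many sections hold on the whole fibre. -/
theorem exists_frame (D : Triple) : ∃ h : X → ℝ, (∀ x, 0 < h x) ∧ Measurable h ∧
    ∃ u : ℕ → D.space, ∀ i, ∀ᵐ x ∂D.μ, (u i : Lp E 2 D.μ) x =
      if (i : ℕ∞) < D.ν x then (h x : ℂ) • e i else 0 := by
  obtain ⟨g, hg0, hgm, hg⟩ := exists_pos_lintegral_lt_of_sigmaFinite D.μ one_ne_zero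
  have hm : Measurable fun x => √(g x : ℝ) := (measurable_coe_nnreal_real.comp hgm).sqrt
  refine ⟨fun x => √(g x : ℝ), fun x => Real.sqrt_pos.2 (hg0 x), hm, ?_⟩
  have hex : ∀ i : ℕ, ∃ u : D.space, ∀ᵐ x ∂D.μ, (u : Lp E 2 D.μ) x =
      if (i : ℕ∞) < D.ν x then ((√(g x : ℝ) : ℝ) : ℂ) • e i else 0 := by
    intro i
    have hmeas : AEStronglyMeasurable (fun x => if (i : ℕ∞) < D.ν x then
        ((√(g x : ℝ) : ℝ) : ℂ) • e i else 0) D.μ := by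
      refine StronglyMeasurable.aestronglyMeasurable ?_
      refine StronglyMeasurable.ite (D.measurableSet_lt_ν i) ?_
        stronglyMeasurable_const
      exact (Complex.measurable_ofReal.comp hm).stronglyMeasurable.smul stronglyMeasurable_const
    refine exists_space ⟨hmeas, ?_⟩ (Filter.Eventually.of_forall fun x => ?_)
    · rw [eLpNorm_lt_top_iff_lintegral_rpow_enorm_lt_top (by simp) (by simp)]
      refine lt_of_le_of_lt (lintegral_mono fun x => ?_) (hg.trans ENNReal.one_lt_top)
      split_ifs
      · rw [enorm_smul, ← ofReal_norm (e i), orthonormal_e.1 i, ← ofReal_norm, Complex.norm_real,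
          Real.norm_of_nonneg (Real.sqrt_nonneg _), ENNReal.ofReal_one, mul_one,
          ENNReal.toReal_ofNat, ENNReal.rpow_ofNat, ← ENNReal.ofReal_pow (Real.sqrt_nonneg _),
          Real.sq_sqrt (NNReal.coe_nonneg _), ENNReal.ofReal_coe_nnreal]
      · simp
    · split_ifs with h
      · exact Submodule.smul_mem _ _ (e_mem_fiber h)
      · exact Submodule.zero_mem _
  choose u hu using hex
  exact ⟨u, hu⟩

/-- As `ν ≥ 1`, the section `u 0` vanishes almost nowhere, so `μ ≪ |u 0|² μ`. The latter is the
reflection of `|C (u 0)|² μ`, hence `μ` is dominated by its reflection; reflecting once more gives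
the converse. -/
theorem refl_absolutelyContinuous {C : D.space →ₛₗᵢ[starRingEnd ℂ] D.space}
    (hC : ∀ k, {x : X | x k = 0} ∈ reflSets C) :
    D.μ.map (fun x => 1 - x) ≪ D.μ ∧ D.μ ≪ D.μ.map (fun x => 1 - x) := by
  obtain ⟨h, h0, -, u, hu⟩ := D.exists_frame
  have h1 : D.μ ≪ D.μ.withDensity fun x => ‖(u 0 : Lp E 2 D.μ) x‖ₑ ^ 2 := by
    refine withDensity_absolutelyContinuous' (measurable_enorm_sq _).aemeasurable ?_
    filter_upwards [hu 0] with x hx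
    have hν : ((0 : ℕ) : ℕ∞) < D.ν x := lt_of_lt_of_le (by simp) (D.one_le_ν x)
    rw [hx, if_pos hν]
    simp [(h0 x).ne', orthonormal_e.ne_zero]
  rw [← map_withDensity_conj hC] at h1
  have h2 : D.μ ≪ D.μ.map (fun x => 1 - x) :=
    h1.trans ((withDensity_absolutelyContinuous _ _).map measurable_refl)
  refine ⟨?_, h2⟩
  have h3 := h2.map measurable_refl
  rw [Measure.map_map measurable_refl measurable_refl, involutive_refl.comp_self,
    Measure.map_id] at h3
  exact h3

/-- Equality of the measures in `map_withDensity_conj` is equality of their densities. -/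
theorem norm_refl_conj {C : D.space →ₛₗᵢ[starRingEnd ℂ] D.space}
    (hC : ∀ k, {x : X | x k = 0} ∈ reflSets C) (f : D.space) :
    ∀ᵐ x ∂D.μ, ‖(f : Lp E 2 D.μ) x‖ =
      wt D.μ (fun x => 1 - x) x * ‖(C f : Lp E 2 D.μ) (1 - x)‖ := by
  have hq : Measure.QuasiMeasurePreserving (fun x : X => 1 - x) D.μ D.μ :=
    ⟨measurable_refl, (refl_absolutelyContinuous hC).1⟩
  have h1 := map_withDensity_conj hC f
  rw [map_withDensity_involutive hq involutive_refl (measurable_enorm_sq _)] at h1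
  have h2 := (withDensity_eq_iff (measurable_enorm_sq f).aemeasurable
    ((Measure.measurable_rnDeriv _ _).mul
      ((measurable_enorm_sq (C f)).comp measurable_refl)).aemeasurable
    (by rw [lintegral_enorm_sq]; simp)).1 h1.symm
  filter_upwards [h2, ofReal_wt_sq hq involutive_refl] with x h3 h4
  rw [Pi.mul_apply, Function.comp_apply] at h3
  rw [← h4, ← ofReal_norm, ← ofReal_norm, ← ENNReal.ofReal_pow (norm_nonneg _),
    ← ENNReal.ofReal_pow (norm_nonneg _), ← ENNReal.ofReal_mul (sq_nonneg _),
    ENNReal.ofReal_eq_ofReal_iff (sq_nonneg _) (by positivity), ← mul_pow] at h3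
  exact (sq_eq_sq₀ (norm_nonneg _) (mul_nonneg (wt_nonneg _ _) (norm_nonneg _))).1 h3

end Triple

/-! ### Decomposition of a conjugation over the base -/

/-- The operator `v ↦ conj (A (conj v))`. -/
def conjOp (A : E →L[ℂ] E) : E →L[ℂ] E :=
  LinearMap.mkContinuous
    { toFun := fun v => star (A (star v))
      map_add' := fun v w => by simp
      map_smul' := fun a v => by simp [star_smul] } ‖A‖ fun v => by
    simpa using A.le_opNorm (star v)

theorem conjOp_apply (A : E →L[ℂ] E) (v : E) : conjOp A v = star (A (star v)) := rfl

theorem conjOp_conjOp (A : E →L[ℂ] E) : conjOp (conjOp A) = A := by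
  ext1 v
  simp [conjOp_apply]

theorem conjOp_one : conjOp (1 : E →L[ℂ] E) = 1 := by
  ext1 v
  simp [conjOp_apply]

theorem conjOp_comp (A B : E →L[ℂ] E) : conjOp (A ∘L B) = conjOp A ∘L conjOp B := by
  ext1 v
  simp [conjOp_apply]

/-- A fibre contains an orthonormal family of `n` vectors only if its dimension is at least
`n`. -/
theorem le_of_orthonormal_fiber {n m : ℕ∞} {a : ℕ → E}
    (hm : ∀ i : ℕ, (i : ℕ∞) < n → a i ∈ fiber m)
    (ho : ∀ i j : ℕ, (i : ℕ∞) < n → (j : ℕ∞) < n → inner ℂ (a i) (a j) = if i = j then 1 else 0) :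
    n ≤ m := by
  by_contra! hlt
  obtain ⟨M, rfl⟩ := ENat.ne_top_iff_exists.1 hlt.ne_top
  have hle : ∀ i : Fin (M + 1), ((i : ℕ) : ℕ∞) < n := fun i =>
    lt_of_le_of_lt (by exact_mod_cast Nat.lt_succ_iff.1 i.2) hlt
  have hon : Orthonormal ℂ fun i : Fin (M + 1) => a i := by
    rw [orthonormal_iff_ite]
    intro i j
    rw [ho _ _ (hle i) (hle j)]
    simp [Fin.ext_iff]
  -- The first `M` coordinates determine a vector of `fiber M`, so `M + 1` orthonormal vectors there
  -- would stay independent in dimension `M`.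
  let L : E →ₗ[ℂ] (Fin M → ℂ) :=
    { toFun := fun v i => v i
      map_add' := fun v w => by ext; simp
      map_smul' := fun c v => by ext; simp }
  have hspan : Submodule.span ℂ (Set.range fun i : Fin (M + 1) => a i) ≤ fiber M := by
    rw [Submodule.span_le]
    rintro _ ⟨i, rfl⟩
    exact hm _ (hle i)
  have hdisj : Disjoint (Submodule.span ℂ (Set.range fun i : Fin (M + 1) => a i)) L.ker := by
    rw [Submodule.disjoint_def]
    intro v hv hv'
    ext i
    by_cases hi : i < M
    · exact congrFun (LinearMap.mem_ker.1 hv') ⟨i, hi⟩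
    · exact hspan hv i (by exact_mod_cast not_lt.1 hi)
  have := (hon.linearIndependent.map hdisj).fintype_card_le_finrank
  simp at this

theorem exists_isometry_of_orthonormal {b : ℕ → E} (hb : Orthonormal ℂ b) :
    ∃ A : E →L[ℂ] E, (∀ v, ‖A v‖ = ‖v‖) ∧ ∀ i, A (e i) = b i := by
  refine ⟨(hb.orthogonalFamily.linearIsometry).toContinuousLinearMap, fun v =>
    LinearIsometry.norm_map _ v, fun i => ?_⟩
  simp [e]

theorem inner_map_map_of_norm {A : E →L[ℂ] E} (hA : ∀ v, ‖A v‖ = ‖v‖) (v w : E) :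
    inner ℂ (A v) (A w) = inner ℂ v w :=
  LinearIsometry.inner_map_map (⟨A.toLinearMap, hA⟩ : E →ₗᵢ[ℂ] E) v w

theorem map_mem_fiber_of_fix {n : ℕ∞} {A : E →L[ℂ] E} (hA : ∀ v, ‖A v‖ = ‖v‖)
    (hfix : ∀ i : ℕ, n ≤ (i : ℕ∞) → A (e i) = e i) {v : E} (hv : v ∈ fiber n) :
    A v ∈ fiber n := by
  intro i hi
  rw [← inner_e, ← hfix i hi, inner_map_map_of_norm hA, inner_e, hv i hi]

theorem adjoint_mem_fiber_of_fix {n : ℕ∞} {A : E →L[ℂ] E}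
    (hfix : ∀ i : ℕ, n ≤ (i : ℕ∞) → A (e i) = e i) {v : E} (hv : v ∈ fiber n) :
    ContinuousLinearMap.adjoint A v ∈ fiber n := by
  intro i hi
  rw [← inner_e, ContinuousLinearMap.adjoint_inner_right, hfix i hi, inner_e, hv i hi]

namespace Triple

variable {D : Triple}

/-- The pointwise composition of the standard conjugation with `C`. -/
def reflComp (C : D.space → D.space) (f : D.space) (x : X) : E :=
  ((wt D.μ (fun x => 1 - x) x : ℝ) : ℂ) • star ((C f : Lp E 2 D.μ) (1 - x))

variable {C : D.space →ₛₗᵢ[starRingEnd ℂ] D.space}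

theorem quasi_refl (hC : ∀ k, {x : X | x k = 0} ∈ reflSets C) :
    Measure.QuasiMeasurePreserving (fun x : X => 1 - x) D.μ D.μ :=
  ⟨measurable_refl, (refl_absolutelyContinuous hC).1⟩

theorem norm_reflComp (hC : ∀ k, {x : X | x k = 0} ∈ reflSets C)
    (f : D.space) :
    ∀ᵐ x ∂D.μ, ‖reflComp C f x‖ = ‖(f : Lp E 2 D.μ) x‖ := by
  filter_upwards [norm_refl_conj hC f] with x hx
  rw [reflComp, norm_smul, norm_star, Complex.norm_real, Real.norm_of_nonneg (wt_nonneg _ _), hx]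

theorem reflComp_add (hC : ∀ k, {x : X | x k = 0} ∈ reflSets C)
    (f g : D.space) :
    ∀ᵐ x ∂D.μ, reflComp C (f + g) x = reflComp C f x + reflComp C g x := by
  filter_upwards [(quasi_refl hC).ae (coe_add_ae (C f) (C g))] with x hx
  rw [reflComp, map_add, hx, star_add, smul_add, reflComp, reflComp]

theorem reflComp_smul (hC : ∀ k, {x : X | x k = 0} ∈ reflSets C)
    (a : ℂ) (f : D.space) :
    ∀ᵐ x ∂D.μ, reflComp C (a • f) x = a • reflComp C f x := by
  filter_upwards [(quasi_refl hC).ae (coe_smul_ae ((starRingEnd ℂ) a) (C f))] with x hx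
  have hs : star ((starRingEnd ℂ) a) = a := star_star a
  rw [reflComp, LinearIsometry.map_smulₛₗ, hx, star_smul, smul_comm, hs]
  rfl

theorem norm_add_smul_reflComp (hC : ∀ k, {x : X | x k = 0} ∈ reflSets C)
    (f g : D.space) (a : ℂ) :
    ∀ᵐ x ∂D.μ, ‖reflComp C f x + a • reflComp C g x‖ =
      ‖(f : Lp E 2 D.μ) x + a • (g : Lp E 2 D.μ) x‖ := by
  filter_upwards [norm_reflComp hC (f + a • g), reflComp_add hC f (a • g), reflComp_smul hC a g,
    coe_add_ae f (a • g), coe_smul_ae a g] with x h1 h2 h3 h4 h5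
  rwa [h2, h3, h4, h5] at h1

/-- Polarization: only the four scalars `±1`, `±i` are needed, so the exceptional null sets cause no
difficulty. -/
theorem inner_reflComp (hC : ∀ k, {x : X | x k = 0} ∈ reflSets C)
    (f g : D.space) :
    ∀ᵐ x ∂D.μ, inner ℂ (reflComp C f x) (reflComp C g x) =
      inner ℂ ((f : Lp E 2 D.μ) x) ((g : Lp E 2 D.μ) x) := by
  filter_upwards [norm_add_smul_reflComp hC f g 1, norm_add_smul_reflComp hC f g (-1),
    norm_add_smul_reflComp hC f g Complex.I, norm_add_smul_reflComp hC f g (-Complex.I)]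
    with x h1 h2 h3 h4
  simp only [one_smul, neg_smul, ← sub_eq_add_neg] at h1 h2 h3 h4
  rw [inner_eq_sum_norm_sq_div_four, inner_eq_sum_norm_sq_div_four]
  change ((‖reflComp C f x + reflComp C g x‖ : ℂ) ^ 2 - (‖reflComp C f x - reflComp C g x‖ : ℂ) ^ 2
    + ((‖reflComp C f x - Complex.I • reflComp C g x‖ : ℂ) ^ 2 -
      (‖reflComp C f x + Complex.I • reflComp C g x‖ : ℂ) ^ 2) * Complex.I) / 4 = _
  rw [h1, h2, h3, h4]
  rfl

theorem reflComp_mem_fiber (hC : ∀ k, {x : X | x k = 0} ∈ reflSets C)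
    (f : D.space) :
    ∀ᵐ x ∂D.μ, reflComp C f x ∈ fiber (D.ν (1 - x)) := by
  filter_upwards [(quasi_refl hC).ae (D.coe_mem_fiber (C f))] with x hx
  exact Submodule.smul_mem _ _ (star_mem_fiber hx)

theorem aestronglyMeasurable_reflComp (hC : ∀ k, {x : X | x k = 0} ∈ reflSets C)
    (f : D.space) :
    AEStronglyMeasurable (reflComp C f) D.μ :=
  (Complex.measurable_ofReal.comp (measurable_wt _)).aestronglyMeasurable.smul
    ((aestronglyMeasurable_coe (C f)).comp_quasiMeasurePreserving (quasi_refl hC)).star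

/-- The images of the basis vectors of the fibres under the decomposition. -/
theorem exists_frame_reflComp (hC : ∀ k, {x : X | x k = 0} ∈ reflSets C) :
    ∃ a : ℕ → X → E,
    (∀ i, AEStronglyMeasurable (a i) D.μ) ∧
    (∀ᵐ x ∂D.μ, ∀ i : ℕ, (i : ℕ∞) < D.ν x → a i x ∈ fiber (D.ν (1 - x))) ∧
    (∀ᵐ x ∂D.μ, ∀ i j : ℕ, (i : ℕ∞) < D.ν x → (j : ℕ∞) < D.ν x →
      inner ℂ (a i x) (a j x) = if i = j then 1 else 0) ∧
    ∀ f : D.space, ∀ᵐ x ∂D.μ, ∀ i : ℕ, (i : ℕ∞) < D.ν x →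
      inner ℂ (a i x) (reflComp C f x) = (((f : Lp E 2 D.μ) x : E) : ℕ → ℂ) i := by
  obtain ⟨h, h0, hm, u, hu⟩ := D.exists_frame
  have hu' := ae_all_iff.2 hu
  have hh : ∀ x, ((h x : ℂ)⁻¹) * (h x : ℂ) = 1 := fun x =>
    inv_mul_cancel₀ (Complex.ofReal_ne_zero.2 (h0 x).ne')
  have hconj : ∀ x, (starRingEnd ℂ) ((h x : ℂ)⁻¹) = (h x : ℂ)⁻¹ := fun x => by
    rw [map_inv₀, Complex.conj_ofReal]
  have hlast : ∀ f : D.space, ∀ᵐ x ∂D.μ, ∀ i : ℕ, (i : ℕ∞) < D.ν x →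
      inner ℂ ((h x : ℂ)⁻¹ • reflComp C (u i) x) (reflComp C f x) =
        (((f : Lp E 2 D.μ) x : E) : ℕ → ℂ) i := by
    intro f
    filter_upwards [hu', ae_all_iff.2 fun i => inner_reflComp hC (u i) f] with x h1 h2 i hi
    rw [inner_smul_left, h2, h1, if_pos hi, inner_smul_left, inner_e, hconj, Complex.conj_ofReal,
      ← mul_assoc, hh, one_mul]
  -- Dividing by `h` undoes the scaling of the frame, so these are the images of the vectors `e i`.
  refine ⟨fun i x => (h x : ℂ)⁻¹ • reflComp C (u i) x, fun i => ?_, ?_, ?_, hlast⟩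
  · exact (Complex.measurable_ofReal.comp hm).inv.aestronglyMeasurable.smul
      (aestronglyMeasurable_reflComp hC (u i))
  · filter_upwards [ae_all_iff.2 fun i => reflComp_mem_fiber hC (u i)] with x h1 i _
    exact Submodule.smul_mem _ _ (h1 i)
  · filter_upwards [ae_all_iff.2 fun j => hlast (u j), hu'] with x h1 h2 i j hi hj
    rw [inner_smul_right, h1 j i hi, h2, if_pos hj, lp.coeFn_smul, Pi.smul_apply, e_apply,
      smul_eq_mul, ← mul_assoc, hh, one_mul]

theorem ν_refl_of_conj (hC : ∀ k, {x : X | x k = 0} ∈ reflSets C) :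
    ∀ᵐ x ∂D.μ, D.ν (1 - x) = D.ν x := by
  obtain ⟨a, -, h1, h2, -⟩ := exists_frame_reflComp hC
  have hle : ∀ᵐ x ∂D.μ, D.ν x ≤ D.ν (1 - x) := by
    filter_upwards [h1, h2] with x h1 h2
    exact le_of_orthonormal_fiber h1 h2
  -- The same inequality at the reflected point gives the other direction, also for infinite
  -- dimensions.
  filter_upwards [hle, (quasi_refl hC).ae hle] with x h3 h4
  rw [sub_sub_cancel] at h4
  exact le_antisymm h4 h3

/-- `A x` sends the basis of the fibre to the orthonormal family of `exists_frame_reflComp` and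
fixes the remaining `e i`. Surjectivity is not claimed here; in infinite dimension it will come from
`C² = 1`. -/
theorem exists_isometry_field (hC : ∀ k, {x : X | x k = 0} ∈ reflSets C) :
    ∃ A : X → E →L[ℂ] E,
    (∀ i, AEStronglyMeasurable (fun x => A x (e i)) D.μ) ∧
    (∀ x v, ‖A x v‖ = ‖v‖) ∧
    (∀ᵐ x ∂D.μ, ∀ i : ℕ, D.ν x ≤ (i : ℕ∞) → A x (e i) = e i) ∧
    ∀ f : D.space, ∀ᵐ x ∂D.μ, reflComp C f x = A x ((f : Lp E 2 D.μ) x) := by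
  classical
  obtain ⟨a, ham, h1, h2, h3⟩ := exists_frame_reflComp hC
  let b : X → ℕ → E := fun x i => if (i : ℕ∞) < D.ν x then a i x else e i
  have hb : ∀ᵐ x ∂D.μ, Orthonormal ℂ (b x) := by
    filter_upwards [h1, h2, ν_refl_of_conj hC] with x h1 h2 hν
    rw [orthonormal_iff_ite]
    intro i j
    simp only [b]
    by_cases hi : (i : ℕ∞) < D.ν x <;> by_cases hj : (j : ℕ∞) < D.ν x
    · rw [if_pos hi, if_pos hj, h2 i j hi hj]
    · have hij : i ≠ j := by rintro rfl; exact hj hi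
      rw [if_pos hi, if_neg hj, if_neg hij, ← inner_conj_symm, inner_e,
        h1 i hi j (by rw [hν]; exact not_lt.1 hj), map_zero]
    · have hij : i ≠ j := by rintro rfl; exact hi hj
      rw [if_neg hi, if_pos hj, if_neg hij, inner_e,
        h1 j hj i (by rw [hν]; exact not_lt.1 hi)]
    · rw [if_neg hi, if_neg hj, orthonormal_iff_ite.1 orthonormal_e]
  have hex : ∀ x, ∃ A : E →L[ℂ] E, (∀ v, ‖A v‖ = ‖v‖) ∧
      (Orthonormal ℂ (b x) → ∀ i, A (e i) = b x i) := by
    intro x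
    by_cases h : Orthonormal ℂ (b x)
    · obtain ⟨A, hA, hA'⟩ := exists_isometry_of_orthonormal h
      exact ⟨A, hA, fun _ => hA'⟩
    · exact ⟨1, fun v => rfl, fun h' => absurd h' h⟩
  choose A hA hA' using hex
  have hAb : ∀ᵐ x ∂D.μ, ∀ i, A x (e i) = b x i := by
    filter_upwards [hb] with x hx
    exact hA' x hx
  have hfix : ∀ᵐ x ∂D.μ, ∀ i : ℕ, D.ν x ≤ (i : ℕ∞) → A x (e i) = e i := by
    filter_upwards [hAb] with x hx i hi
    rw [hx]
    exact if_neg (not_lt.2 hi)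
  refine ⟨A, fun i => ?_, hA, hfix, fun f => ?_⟩
  · have hm : AEStronglyMeasurable (fun x => b x i) D.μ := by
      have := AEStronglyMeasurable.piecewise (D.measurableSet_lt_ν i) (ham i).restrict
        (aestronglyMeasurable_const (b := e i)).restrict
      exact this
    refine hm.congr ?_
    filter_upwards [hAb] with x hx
    rw [hx]
  · filter_upwards [hAb, h3 f, norm_reflComp hC f, reflComp_mem_fiber hC f, ν_refl_of_conj hC,
      D.coe_mem_fiber f] with x hx h4 h5 h6 h7 h8
    rw [h7] at h6
    -- Knowing the coefficients of `reflComp C f x` against the image frame and that its norm is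
    -- that of `f x`, equality in Bessel's inequality places it in the range of `A x`.
    have hadj : ContinuousLinearMap.adjoint (A x) (reflComp C f x) = (f : Lp E 2 D.μ) x := by
      ext i
      rw [← inner_e, ContinuousLinearMap.adjoint_inner_right, hx]
      by_cases hi : (i : ℕ∞) < D.ν x
      · simp only [b, if_pos hi]
        exact h4 i hi
      · simp only [b, if_neg hi]
        rw [inner_e, h6 i (not_lt.1 hi), h8 i (not_lt.1 hi)]
    rw [← sub_eq_zero, ← norm_eq_zero, ← sq_eq_zero_iff, norm_sub_sq (𝕜 := ℂ), h5, hA,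
      ← ContinuousLinearMap.adjoint_inner_left, hadj, inner_self_eq_norm_sq]
    ring

theorem conj_apply_of_field (hC : ∀ k, {x : X | x k = 0} ∈ reflSets C)
    {A : X → E →L[ℂ] E}
    (hA : ∀ f : D.space, ∀ᵐ x ∂D.μ, reflComp C f x = A x ((f : Lp E 2 D.μ) x)) (f : D.space) :
    ∀ᵐ x ∂D.μ, (C f : Lp E 2 D.μ) x = ((wt D.μ (fun x => 1 - x) x : ℝ) : ℂ) •
      star (A (1 - x) ((f : Lp E 2 D.μ) (1 - x))) := by
  have hstar : ∀ r : ℝ, star (r : ℂ) = r := Complex.conj_ofReal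
  filter_upwards [(quasi_refl hC).ae (hA f), wt_mul_self (quasi_refl hC) involutive_refl]
    with x h1 h2
  rw [← h1, reflComp, sub_sub_cancel, star_smul, star_star, smul_smul, hstar,
    ← Complex.ofReal_mul, h2, Complex.ofReal_one, one_smul]

theorem conjOp_field_comp (hC : ∀ k, {x : X | x k = 0} ∈ reflSets C)
    (hC2 : ∀ f, C (C f) = f) {A : X → E →L[ℂ] E}
    (hfix : ∀ᵐ x ∂D.μ, ∀ i : ℕ, D.ν x ≤ (i : ℕ∞) → A x (e i) = e i)
    (hA : ∀ f : D.space, ∀ᵐ x ∂D.μ, reflComp C f x = A x ((f : Lp E 2 D.μ) x)) :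
    ∀ᵐ x ∂D.μ, conjOp (A (1 - x)) ∘L A x = 1 := by
  have hq := quasi_refl hC
  obtain ⟨h, h0, -, u, hu⟩ := D.exists_frame
  have hinv : ∀ f : D.space, ∀ᵐ x ∂D.μ,
      conjOp (A (1 - x)) (A x ((f : Lp E 2 D.μ) x)) = (f : Lp E 2 D.μ) x := by
    intro f
    have h1 := conj_apply_of_field hC hA (C f)
    rw [hC2] at h1
    filter_upwards [h1, hA f] with x h1 h2
    rw [conjOp_apply, ← h2, reflComp, star_smul, star_star, map_smul, star_smul, h1]
    simp only [star_star]
  filter_upwards [ae_all_iff.2 fun i => hinv (u i), ae_all_iff.2 hu, hfix, hq.ae hfix,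
    ν_refl_of_conj hC] with x h1 h2 h3 h4 h5
  refine ext_e fun i => ?_
  change conjOp (A (1 - x)) (A x (e i)) = e i
  by_cases hi : (i : ℕ∞) < D.ν x
  · have := h1 i
    rw [h2, if_pos hi, map_smul, map_smul] at this
    exact smul_right_injective _ (Complex.ofReal_ne_zero.2 (h0 x).ne') this
  · rw [h3 i (not_lt.1 hi), conjOp_apply, star_e, h4 i (by rw [h5]; exact not_lt.1 hi), star_e]

/-- A measurable field of unitary operators that carries `C` to the standard conjugation. -/
theorem exists_unitary_field (hC : ∀ k, {x : X | x k = 0} ∈ reflSets C)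
    (hC2 : ∀ f, C (C f) = f) : ∃ W : X → E →L[ℂ] E,
    (∀ i, AEStronglyMeasurable (fun x => W x (e i)) D.μ) ∧
    (∀ x v, ‖W x v‖ = ‖v‖) ∧
    (∀ᵐ x ∂D.μ, W x ∘L ContinuousLinearMap.adjoint (W x) = 1) ∧
    (∀ᵐ x ∂D.μ, ∀ i : ℕ, D.ν x ≤ (i : ℕ∞) → W x (e i) = e i) ∧
    ∀ f : D.space, ∀ᵐ x ∂D.μ, W x ((C f : Lp E 2 D.μ) x) =
      ((wt D.μ (fun x => 1 - x) x : ℝ) : ℂ) • star (W (1 - x) ((f : Lp E 2 D.μ) (1 - x))) := by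
  classical
  have hq := quasi_refl hC
  obtain ⟨A, hm, hn, hfix, hA⟩ := exists_isometry_field hC
  have hinv := conjOp_field_comp hC hC2 hfix hA
  have hS : MeasurableSet {x : X | x 0 = 0} := measurable_pi_apply 0 (measurableSet_singleton 0)
  have hinv' : ∀ᵐ x ∂D.μ, A x ∘L conjOp (A (1 - x)) = 1 := by
    filter_upwards [hq.ae hinv] with x hx
    rw [sub_sub_cancel] at hx
    rw [← conjOp_conjOp (A x), ← conjOp_comp, hx, conjOp_one]
  -- Exactly one of `x` and `1 - x` has zeroth coordinate `0`, so of `W x` and `W (1 - x)` one is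
  -- the identity and the other is `A`. The required identity is then the formula for `C` in terms
  -- of `A` or the relation `hinv'`.
  refine ⟨fun x => if x 0 = 0 then 1 else A x, fun i => ?_, fun x v => ?_, ?_, ?_, fun f => ?_⟩
  · have := AEStronglyMeasurable.piecewise hS
      (aestronglyMeasurable_const (b := e i) (μ := D.μ)).restrict (hm i).restrict
    refine this.congr (Filter.Eventually.of_forall fun x => ?_)
    by_cases hx : x 0 = 0 <;> simp [Set.piecewise, hx]
  · by_cases hx : x 0 = 0 <;> simp [hx, hn]
  · filter_upwards [hinv'] with x h2
    by_cases hx : x 0 = 0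
    · simp only [hx, if_true]
      rw [← ContinuousLinearMap.star_eq_adjoint, star_one]
      rfl
    · simp only [hx, if_false]
      have h1 := (ContinuousLinearMap.norm_map_iff_adjoint_comp_self (A x)).1 (hn x)
      -- The left inverse of the isometry `A x` coincides with its right inverse, so `A x` is
      -- unitary.
      have h3 : ContinuousLinearMap.adjoint (A x) = conjOp (A (1 - x)) := by
        have h4 : ContinuousLinearMap.adjoint (A x) ∘L (A x ∘L conjOp (A (1 - x))) =
            conjOp (A (1 - x)) := by
          rw [← ContinuousLinearMap.comp_assoc, h1]
          rfl
        rw [← h4, h2]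
        rfl
      rw [h3, h2]
  · filter_upwards [hfix] with x h1 i hi
    by_cases hx : x 0 = 0 <;> simp [hx, h1 i hi]
  · filter_upwards [conj_apply_of_field hC hA f, hinv'] with x h1 h2
    have h01 : (1 - x) 0 = 1 - x 0 := rfl
    rcases zmod_two_cases (x 0) with hx | hx
    · rw [h01]
      simp [hx, h1]
    · rw [h01, h1]
      simp only [hx, sub_self, if_true, one_ne_zero, if_false, map_smul]
      have h3 := congrArg (fun B : E →L[ℂ] E => B (star ((f : Lp E 2 D.μ) (1 - x)))) h2
      simp only [ContinuousLinearMap.comp_apply, conjOp_apply, star_star] at h3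
      rw [h3]
      rfl

end Triple

/-! ### Change of the trivialization -/

/-- Fixing the basis vectors off the fibre makes `W`, `W'` and their adjoints preserve the fibre. -/
theorem isUnitaryOn_conj {n : ℕ∞} {A W W' : E →L[ℂ] E} (hA : IsUnitaryOn (fiber n) A)
    (hW : ∀ v, ‖W v‖ = ‖v‖) (hW' : ∀ v, ‖W' v‖ = ‖v‖)
    (hu : W ∘L ContinuousLinearMap.adjoint W = 1)
    (hu' : W' ∘L ContinuousLinearMap.adjoint W' = 1)
    (hf : ∀ i : ℕ, n ≤ (i : ℕ∞) → W (e i) = e i)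
    (hf' : ∀ i : ℕ, n ≤ (i : ℕ∞) → W' (e i) = e i) :
    IsUnitaryOn (fiber n) (W ∘L A ∘L ContinuousLinearMap.adjoint W') := by
  have h1 : ∀ v, W (ContinuousLinearMap.adjoint W v) = v := fun v =>
    congrArg (fun B : E →L[ℂ] E => B v) hu
  have h1' : ∀ v, W' (ContinuousLinearMap.adjoint W' v) = v := fun v =>
    congrArg (fun B : E →L[ℂ] E => B v) hu'
  have h2' : ∀ v, ContinuousLinearMap.adjoint W' (W' v) = v := fun v =>
    congrArg (fun B : E →L[ℂ] E => B v)
      ((ContinuousLinearMap.norm_map_iff_adjoint_comp_self W').1 hW')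
  refine ⟨fun v hv => ?_, le_antisymm ?_ fun w hw => ?_, fun v hv => ?_⟩
  · change ‖W (A (ContinuousLinearMap.adjoint W' v))‖ = ‖v‖
    rw [hW, hA.norm_map _ (adjoint_mem_fiber_of_fix hf' hv), ← hW', h1']
  · rintro _ ⟨v, hv, rfl⟩
    exact map_mem_fiber_of_fix hW hf (hA.map_mem (adjoint_mem_fiber_of_fix hf' hv))
  · have hw' := adjoint_mem_fiber_of_fix hf hw
    rw [← hA.map_eq] at hw'
    obtain ⟨u, hu, huw⟩ := hw'
    refine ⟨W' u, map_mem_fiber_of_fix hW' hf' hu, ?_⟩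
    change W (A (ContinuousLinearMap.adjoint W' (W' u))) = w
    rw [h2']
    change A u = _ at huw
    rw [huw, h1]
  · change W (A (ContinuousLinearMap.adjoint W' v)) = 0
    rw [hA.map_orthogonal, map_zero]
    rw [Submodule.mem_orthogonal]
    intro u hu
    rw [ContinuousLinearMap.adjoint_inner_right]
    have huF := map_mem_fiber_of_fix hW' hf' hu
    exact (Submodule.mem_orthogonal _ _).1 hv _ huF

/-- A measurable field of unitary operators of the fibres of `D`, extended by the identity. -/
structure UnitaryField (D : Triple) where
  W : X → E →L[ℂ] E
  measurable : ∀ i, AEStronglyMeasurable (fun x => W x (e i)) D.μ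
  norm_map : ∀ x v, ‖W x v‖ = ‖v‖
  comp_adjoint : ∀ᵐ x ∂D.μ, W x ∘L ContinuousLinearMap.adjoint (W x) = 1
  fix : ∀ᵐ x ∂D.μ, ∀ i : ℕ, D.ν x ≤ (i : ℕ∞) → W x (e i) = e i

namespace UnitaryField

variable {D : Triple} (F : UnitaryField D)

theorem adjoint_comp (x : X) : ContinuousLinearMap.adjoint (F.W x) ∘L F.W x = 1 :=
  (ContinuousLinearMap.norm_map_iff_adjoint_comp_self _).1 (F.norm_map x)

theorem adjoint_apply (x : X) (v : E) : ContinuousLinearMap.adjoint (F.W x) (F.W x v) = v :=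
  congrArg (fun B : E →L[ℂ] E => B v) (F.adjoint_comp x)

theorem apply_adjoint : ∀ᵐ x ∂D.μ, ∀ v, F.W x (ContinuousLinearMap.adjoint (F.W x) v) = v := by
  filter_upwards [F.comp_adjoint] with x hx v
  exact congrArg (fun B : E →L[ℂ] E => B v) hx

/-- The triple with the operators `W(x) c_k(x) W(x + δ_k)^*`. -/
def twist : Triple where
  μ := D.μ
  sigmaFinite := D.sigmaFinite
  quasiInvariant := D.quasiInvariant
  ν := D.ν
  measurable_ν := D.measurable_ν
  one_le_ν := D.one_le_ν
  ν_add := D.ν_add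
  c k x := F.W x ∘L D.c k x ∘L ContinuousLinearMap.adjoint (F.W (x + delta k))
  measurable_c k v := aestronglyMeasurable_apply (A := F.W) F.measurable
    (aestronglyMeasurable_apply (A := D.c k) (fun i => D.measurable_c k (e i))
      ((aestronglyMeasurable_adjoint F.measurable v).comp_quasiMeasurePreserving
        (D.quasi_shift k)))
  unitary_c k := by
    filter_upwards [D.unitary_c k, F.comp_adjoint, F.fix, (D.quasi_shift k).ae F.comp_adjoint,
      (D.quasi_shift k).ae F.fix, D.ν_add _ (delta_mem_Delta k)] with x h1 h2 h3 h4 h5 h6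
    rw [h6] at h5
    exact isUnitaryOn_conj h1 (F.norm_map _) (F.norm_map _) h2 h4 h3 h5
  adjoint_c k := by
    filter_upwards [D.adjoint_c k] with x h1
    rw [ContinuousLinearMap.adjoint_comp, ContinuousLinearMap.adjoint_comp,
      ContinuousLinearMap.adjoint_adjoint, h1, add_delta_add_delta,
      ContinuousLinearMap.comp_assoc]
  comm_c k l := by
    filter_upwards [D.comm_c k l] with x h1
    ext1 v
    have h2 := congrArg (fun B : E →L[ℂ] E =>
      F.W x (B (ContinuousLinearMap.adjoint (F.W (x + delta k + delta l)) v))) h1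
    simp only [ContinuousLinearMap.comp_apply, F.adjoint_apply, add_right_comm x (delta l)]
      at h2 ⊢
    exact h2

/-- The unitary operator of the direct integrals that belongs to the field. -/
theorem exists_unitary : ∃ U : D.space ≃ₗᵢ[ℂ] F.twist.space, ∀ f : D.space, ∀ᵐ x ∂D.μ,
    (U f : Lp E 2 F.twist.μ) x = F.W x ((f : Lp E 2 D.μ) x) := by
  -- Taking the identity as the involution, with weight `1`, makes fibrewise operators a case of
  -- `exists_isometry`.
  have hq : Measure.QuasiMeasurePreserving (id : X → X) D.μ D.μ :=
    Measure.QuasiMeasurePreserving.id _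
  have hi : Function.Involutive (id : X → X) := fun x => rfl
  obtain ⟨T, hT⟩ := Triple.exists_isometry hq hi (A := F.W) F.measurable (by
    filter_upwards [F.fix] with x hx v hv
    exact ⟨map_mem_fiber_of_fix (F.norm_map x) hx hv, F.norm_map x v⟩)
  obtain ⟨S, hS⟩ := Triple.exists_isometry hq hi
    (A := fun x => ContinuousLinearMap.adjoint (F.W x))
    (fun i => aestronglyMeasurable_adjoint F.measurable _) (by
      filter_upwards [F.fix, F.apply_adjoint] with x hx hx' v hv
      refine ⟨adjoint_mem_fiber_of_fix hx hv, ?_⟩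
      rw [← F.norm_map x, hx'])
  have hT' : ∀ f : D.space, ∀ᵐ x ∂D.μ, (T f : Lp E 2 D.μ) x = F.W x ((f : Lp E 2 D.μ) x) := by
    intro f
    filter_upwards [hT f, wt_id (μ := D.μ)] with x h1 h2
    rw [h1, h2, Complex.ofReal_one, one_smul, id]
  have hsurj : Function.Surjective T := by
    intro g
    refine ⟨S g, Triple.space_ext ?_⟩
    filter_upwards [hT' (S g), hS g, wt_id (μ := D.μ), F.apply_adjoint] with x h1 h2 h3 h4
    rw [h1, h2, h3, Complex.ofReal_one, one_smul, id, h4]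
  exact ⟨LinearIsometryEquiv.ofSurjective T hsurj, hT'⟩

/-- The adjoint at `x + δ_k` in the twisted operator cancels the factor that `U` introduces there.
-/
theorem basisFormula_twist {U : D.space → F.twist.space}
    (hU : ∀ f : D.space, ∀ᵐ x ∂D.μ, (U f : Lp E 2 F.twist.μ) x = F.W x ((f : Lp E 2 D.μ) x))
    (i : ℕ ⊕ ℕ) (f : D.space) : ∀ᵐ x ∂D.μ,
      F.twist.basisFormula i (U f) x = F.W x (D.basisFormula i f x) := by
  filter_upwards [(D.quasi_shift (coordIdx i)).ae (hU f)] with x h1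
  change coef i x • F.W x (D.c (coordIdx i) x (ContinuousLinearMap.adjoint
    (F.W (x + delta (coordIdx i))) (((wt D.μ (fun y => y + delta (coordIdx i)) x : ℝ) : ℂ) •
      (U f : Lp E 2 F.twist.μ) (x + delta (coordIdx i))))) = _
  rw [h1, map_smul (ContinuousLinearMap.adjoint _), F.adjoint_apply, Triple.basisFormula,
    map_smul (F.W x)]

end UnitaryField

/-! ### Transport of representations -/

section Transport

variable {Z : Type*} [NormedAddCommGroup Z] [InnerProductSpace ℝ Z]
  {H H' : Type*} [NormedAddCommGroup H] [InnerProductSpace ℂ H] [NormedAddCommGroup H']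
  [InnerProductSpace ℂ H']

theorem exists_transport (ρ : CliffordAlgebra (negForm Z) →ₐ[ℝ] (H →L[ℂ] H)) (U : H ≃ₗᵢ[ℂ] H')
    (hc : Continuous fun v : Z => ρ (CliffordAlgebra.ι (negForm Z) v)) :
    ∃ ρ' : CliffordAlgebra (negForm Z) →ₐ[ℝ] (H' →L[ℂ] H'),
      (Continuous fun v : Z => ρ' (CliffordAlgebra.ι (negForm Z) v)) ∧
      ∀ a f, U (ρ a f) = ρ' a (U f) := by
  let K := U.toContinuousLinearEquiv.conjContinuousAlgEquiv
  refine ⟨((K.toAlgEquiv.restrictScalars ℝ).toAlgHom).comp ρ, K.continuous.comp hc, fun a f => ?_⟩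
  change U (ρ a f) = U (ρ a (U.symm (U f)))
  rw [U.symm_apply_apply]

end Transport

namespace Triple

variable {D : Triple}

/-- If the standard conjugation commutes with the operators of the basis, then the triple is of
standard type. -/
theorem isStandard_of_conj (h1 : D.μ.map (fun x => 1 - x) ≪ D.μ)
    (h2 : D.μ ≪ D.μ.map (fun x => 1 - x)) (hν : ∀ᵐ x ∂D.μ, D.ν (1 - x) = D.ν x)
    {C : D.space → D.space} (hC : ∀ f : D.space, ∀ᵐ x ∂D.μ, (C f : Lp E 2 D.μ) x =
      ((wt D.μ (fun x => 1 - x) x : ℝ) : ℂ) • star ((f : Lp E 2 D.μ) (1 - x)))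
    {J : ℕ → D.space → D.space} (hJ : ∀ k, ∀ f : D.space, ∀ᵐ x ∂D.μ,
      (J k f : Lp E 2 D.μ) x = D.basisFormula (.inl k) f x)
    (hCJ : ∀ k f, C (J k f) = J k (C f)) : D.IsStandard := by
  have hq : Measure.QuasiMeasurePreserving (fun x : X => 1 - x) D.μ D.μ := ⟨measurable_refl, h1⟩
  refine ⟨h1, h2, hν, fun k => ?_⟩
  have hstar : ∀ r : ℝ, star (r : ℂ) = r := Complex.conj_ofReal
  have hqk := D.quasi_shift k
  obtain ⟨h, h0, -, u, hu⟩ := D.exists_frame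
  -- Evaluate `C (J k f) = J k (C f)` at `x` and cancel the scalar and the weights, which are
  -- nonzero almost everywhere.
  have key : ∀ f : D.space, ∀ᵐ x ∂D.μ,
      star (D.c k (1 - x) ((f : Lp E 2 D.μ) (1 - x + delta k))) =
        (-1 : ℂ) ^ (k + 1) • D.c k x (star ((f : Lp E 2 D.μ) (1 - x + delta k))) := by
    intro f
    have hcomm := hC (J k f)
    rw [hCJ] at hcomm
    filter_upwards [hcomm, hJ k (C f), hq.ae (hJ k f), hqk.ae (hC f),
      wt_mul_comm hq involutive_refl hqk (involutive_shift _)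
        (funext fun x => (one_sub_add_delta _ _).symm), wt_pos hq involutive_refl,
      hq.ae (wt_pos hqk (involutive_shift _))] with x h1 h2 h3 h4 h5 h6 h7
    rw [h2, h3, basisFormula, basisFormula] at h1
    simp only [coordIdx, Sum.elim_inl, id] at h1
    rw [h4, ← one_sub_add_delta, star_smul] at h1
    simp only [map_smul, star_smul, hstar, smul_smul] at h1
    have h8 := star_coef (.inl k) (1 - x)
    rw [sub_sub_cancel] at h8
    simp only [coordIdx, Sum.elim_inl, id] at h8
    rw [← h8] at h1
    have h5' := congrArg (fun r : ℝ => (r : ℂ)) h5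
    simp only [Complex.ofReal_mul] at h5'
    have hne : star (coef (.inl k) (1 - x)) *
        ((wt D.μ (fun x => 1 - x) x : ℂ) * (wt D.μ (fun y => y + delta k) (1 - x) : ℂ)) ≠ 0 := by
      refine mul_ne_zero ?_ (mul_ne_zero (Complex.ofReal_ne_zero.2 h6.ne')
        (Complex.ofReal_ne_zero.2 h7.ne'))
      rw [star_ne_zero, ← norm_ne_zero_iff, norm_coef]
      exact one_ne_zero
    refine smul_right_injective _ hne ?_
    simp only [smul_smul]
    refine Eq.trans ?_ (h1.symm.trans ?_)
    · congr 1
      ring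
    · congr 1
      linear_combination (-(star (coef (.inl k) (1 - x)) * (-1) ^ (k + 1))) * h5'
  -- The frame is evaluated at `1 - x + δ_k`, where it is a nonzero multiple of `e i` for each `i`
  -- below the dimension. For the other `i` both operators vanish, so the identity holds on all of
  -- `E`.
  have hq' := fun {p : X → Prop} (hp : ∀ᵐ x ∂D.μ, p x) => hq.ae (hqk.ae hp)
  filter_upwards [ae_all_iff.2 fun i => key (u i), hq' (ae_all_iff.2 hu), hν,
    hq.ae (D.ν_add _ (delta_mem_Delta k)), D.unitary_c k, hq.ae (D.unitary_c k)]
    with x h1 h2 h3 h4 h5 h6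
  rw [h3] at h4 h6
  have hop : conjOp (D.c k (1 - x)) = (-1 : ℂ) ^ (k + 1) • D.c k x := by
    refine ext_e fun i => ?_
    rw [conjOp_apply, star_e, smul_apply]
    by_cases hi : (i : ℕ∞) < D.ν x
    · have := h1 i
      rw [h2, h4, if_pos hi, map_smul, star_smul, star_smul, star_e, hstar, map_smul,
        smul_comm] at this
      exact smul_right_injective _ (Complex.ofReal_ne_zero.2 (h0 _).ne') this
    · have he := e_mem_fiber_orthogonal (not_lt.1 hi)
      rw [h5.map_orthogonal _ he, h6.map_orthogonal _ he, star_zero, smul_zero]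
  intro v
  exact congrArg (fun B : E →L[ℂ] E => B v) hop

/-! ### Reduction of a module with real form to standard type -/

variable {Z : Type*} [NormedAddCommGroup Z] [InnerProductSpace ℝ Z]

/-- The hypothesis `hF` says that the unitary of the field intertwines `C` with the standard
conjugation of the twisted module. That conjugation therefore commutes with the transported
representation, and `isStandard_of_conj` applies. -/
theorem exists_standard_of_field {b : Frame Z}
    {ρ : CliffordAlgebra (negForm Z) →ₐ[ℝ] (D.space →L[ℂ] D.space)} (hρ : D.IsRep b ρ)
    {C : D.space →ₛₗᵢ[starRingEnd ℂ] D.space} (hCρ : ∀ a f, C (ρ a f) = ρ a (C f))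
    (hC : ∀ k, {x : X | x k = 0} ∈ reflSets C) (F : UnitaryField D)
    (hF : ∀ f : D.space, ∀ᵐ x ∂D.μ, F.W x ((C f : Lp E 2 D.μ) x) =
      ((wt D.μ (fun x => 1 - x) x : ℝ) : ℂ) •
        star (F.W (1 - x) ((f : Lp E 2 D.μ) (1 - x)))) :
    ∃ (h' : F.twist.IsStandard)
      (ρ' : CliffordAlgebra (negForm Z) →ₐ[ℝ] (F.twist.space →L[ℂ] F.twist.space))
      (U : D.space ≃ₗᵢ[ℂ] F.twist.space),
      F.twist.IsRep b ρ' ∧ (∀ a f, U (ρ a f) = ρ' a (U f)) ∧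
        (∀ f, C f = f ↔ U f ∈ h'.realForm) := by
  obtain ⟨hc, hb⟩ := isRep_iff.1 hρ
  obtain ⟨U, hU⟩ := F.exists_unitary
  have htr : ∃ ρ' : CliffordAlgebra (negForm Z) →ₐ[ℝ] (F.twist.space →L[ℂ] F.twist.space),
      (Continuous fun v : Z => ρ' (CliffordAlgebra.ι (negForm Z) v)) ∧
      ∀ a f, U (ρ a f) = ρ' a (U f) := exists_transport ρ U hc
  obtain ⟨ρ', hc', hUρ⟩ := htr
  have hb' : ∀ (i : ℕ ⊕ ℕ) (f : F.twist.space), ∀ᵐ x ∂F.twist.μ,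
      (ρ' (CliffordAlgebra.ι (negForm Z) (Sum.elim b.z (fun k => b.σ (b.z k)) i)) f :
        Lp E 2 F.twist.μ) x = F.twist.basisFormula i f x := by
    intro i g
    obtain ⟨f, rfl⟩ := U.surjective g
    rw [← hUρ]
    filter_upwards [hU (ρ (CliffordAlgebra.ι (negForm Z)
      (Sum.elim b.z (fun k => b.σ (b.z k)) i)) f), hb i f,
      F.basisFormula_twist (U := U) hU i f] with x h1 h2 h3
    rw [h3, ← h2]
    exact h1
  have hac := refl_absolutelyContinuous hC
  have hq : Measure.QuasiMeasurePreserving (fun x : X => 1 - x) F.twist.μ F.twist.μ :=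
    quasi_refl hC
  have hν : ∀ᵐ x ∂F.twist.μ, F.twist.ν (1 - x) = F.twist.ν x := ν_refl_of_conj hC
  obtain ⟨C', hC'⟩ := exists_refl_conj hq hν
  have hUC : ∀ f, U (C f) = C' (U f) := by
    intro f
    refine space_ext ?_
    filter_upwards [hU (C f), hC' (U f), hF f, hq.ae (hU f)] with x h1 h2 h3 h4
    refine h1.trans (h3.trans (Eq.trans ?_ h2.symm))
    rw [h4]
    rfl
  have hstd : F.twist.IsStandard := by
    refine isStandard_of_conj hac.1 hac.2 hν hC' (fun k => hb' (.inl k)) fun k g => ?_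
    obtain ⟨f, rfl⟩ := U.surjective g
    rw [← hUC, ← hUρ, ← hUρ, ← hUC, hCρ]
  refine ⟨hstd, ρ', U, isRep_iff.2 ⟨hc', hb'⟩, hUρ, fun f => ?_⟩
  rw [hstd.mem_realForm_iff_conj hC', ← hUC, U.injective.eq_iff]

theorem exists_standard_of_realForm {b : Frame Z}
    {ρ : CliffordAlgebra (negForm Z) →ₐ[ℝ] (D.space →L[ℂ] D.space)} {V : Submodule ℝ D.space}
    (hρ : D.IsRep b ρ) (hV : IsInvariantRealForm ρ V) :
    ∃ (D' : Triple) (h' : D'.IsStandard)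
      (ρ' : CliffordAlgebra (negForm Z) →ₐ[ℝ] (D'.space →L[ℂ] D'.space))
      (U : D.space ≃ₗᵢ[ℂ] D'.space),
      D'.IsRep b ρ' ∧ (∀ a f, U (ρ a f) = ρ' a (U f)) ∧
        (∀ f, f ∈ V ↔ U f ∈ h'.realForm) := by
  obtain ⟨-, hb⟩ := isRep_iff.1 hρ
  have hex : ∃ C : D.space →ₛₗᵢ[starRingEnd ℂ] D.space, (∀ f, C (C f) = f) ∧
      (∀ f, f ∈ V ↔ C f = f) ∧ ∀ a f, C (ρ a f) = ρ a (C f) := exists_conj_of_realForm hV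
  obtain ⟨C, hC2, hCV, hCρ⟩ := hex
  have hC : ∀ k, {x : X | x k = 0} ∈ reflSets C := fun k =>
    coord_mem_reflSets fun f g hg => sgn_conj (hb (.inl k)) (hb (.inr k)) (hCρ _) (hCρ _) hg
  obtain ⟨W, hWm, hWn, hWu, hWf, hWC⟩ := exists_unitary_field hC hC2
  obtain ⟨h', ρ', U, h1, h2, h3⟩ :=
    exists_standard_of_field hρ hCρ hC ⟨W, hWm, hWn, hWu, hWf⟩ hWC
  exact ⟨_, h', ρ', U, h1, h2, fun f => (hCV f).trans (h3 f)⟩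

end Triple

end GW

end

theorem theorem3p9 {Z : Type*} [NormedAddCommGroup Z] [InnerProductSpace ℝ Z]
    (b : GW.Frame Z) :
    -- the formulas attach to every triple exactly one representation of the Clifford algebra
    (∀ D : GW.Triple, ∃! ρ, D.IsRep b ρ) ∧
    -- for a triple of standard type, the displayed real subspace is an invariant real form
    (∀ (D : GW.Triple) (h : D.IsStandard) (ρ), D.IsRep b ρ →
      GW.IsInvariantRealForm ρ h.realForm) ∧
    -- every module with an invariant real form is unitarily equivalent to one of standard type
    (∀ (D : GW.Triple) (ρ) (V : Submodule ℝ D.space), D.IsRep b ρ → GW.IsInvariantRealForm ρ V →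
      ∃ (D' : GW.Triple) (h' : D'.IsStandard)
        (ρ' : CliffordAlgebra (GW.negForm Z) →ₐ[ℝ] (D'.space →L[ℂ] D'.space))
        (U : D.space ≃ₗᵢ[ℂ] D'.space),
        D'.IsRep b ρ' ∧ (∀ a f, U (ρ a f) = ρ' a (U f)) ∧ (∀ f, f ∈ V ↔ U f ∈ h'.realForm)) :=
  ⟨fun D => D.existsUnique_isRep b, fun _ h _ hρ => h.isInvariantRealForm hρ,
    fun _ _ _ hρ hV => GW.Triple.exists_standard_of_realForm hρ hV⟩
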